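/- Let $\mathbb T=[-\pi,\pi]$, with end points identified; functions and weights on $\mathbb T$ are extended $2\pi$-periodically to $\mathbb R$, and $J$ below ranges over the intervals of the circle, i.e. the intervals of $\mathbb R$ of positive length $|J|\le 2\pi$. A weight is a measurable $2\pi$-periodic function $\gamma:\mathbb R\to[0,\infty]$ that is positive a.e.; put $\gamma(E)=\int_E\gamma$. For $1\le p\le\infty$ the class $A\mathfrak S_p^1$ is defined as follows. * If $1<p<\infty$: $\gamma\in A\mathfrak S_p^1$ iff $\gamma$ is integrable over $\mathbb T$, doubling (there is $C$ with $\gamma(2J)\le C\gamma(J)$ for all $J$, where $2J$ has the midpoint of $J$ and twice its length) and $$[\gamma]_p:=\sup_{J}\frac{\gamma(J)}{|J|}\Big(\frac1{|J|}\int_J\gamma^{-1/(p-1)}\Big)^{p-1}<\infty .$$ * If $p=1$: $\gamma\in A\mathfrak S_1^1$ iff $[\gamma]_1:=\sup_J\gamma(J)/|J|<\infty$ and $\gamma\ge c$ a.e. for some constant $c>0$. * If $p=\infty$: $\gamma\in A\mathfrak S_\infty^1$ iff $\gamma=1$ a.e. Let $L_{p,\gamma}$ be the space of real measurable $2\pi$-periodic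 $f$ with $\|f\|_{p,\gamma}<\infty$, where $\|f\|_{p,\gamma}=(\int_{\mathbb T}|f|^p\gamma\,dx)^{1/p}$ for $p<\infty$ and $\|f\|_{\infty,\gamma}=\operatorname{ess\,sup}_{\mathbb T}|f|$. For $v>0$ let $\mathfrak T_vf(x)=\frac1v\int_x^{x+v}f(s)\,ds$, and for $k\in\mathbb N=\{1,2,\dots\}$ let $\Omega_k(f,v)_{p,\gamma}=\|(\mathbb I-\mathfrak T_v)^kf\|_{p,\gamma}$. **Corollary (Marchaud inequality).** Let $1\le p\le\infty$ and $k\in\mathbb N$. For all $\gamma\in A\mathfrak S_p^1$, $f\in L_{p,\gamma}$ and $0<t<1/2$, $$\Omega_k(f,t)_{p,\gamma}\le C\,t^k\int_t^1\frac{\Omega_{k+1}(f,u)_{p,\gamma}}{u^k}\,\frac{du}{u},$$ where $C>0$ does not depend on $f$ or $t$, and depends on $\gamma$ only as follows: if $1<p<\infty$, $C$ depends only on $k$, $p$ and (an upper bound for) $[\gamma]_p$; if $p=\infty$, $C$ depends only on $k$; if $p=1$, $C$ depends only on $k$, (an upper bound for) $[\gamma]_1$ and the lower bound $c$ of $\gamma$.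 -/

import Mathlib

open MeasureTheory Set
open scoped ENNReal NNReal

noncomputable section

/-- A weight on the circle `𝕋 = ℝ / 2πℤ`: a measurable `2π`-periodic function with values in
`[0, ∞]` which is positive almost everywhere. -/
structure IsWeight (γ : ℝ → ℝ≥0∞) : Prop where
  measurable : Measurable γ
  periodic : Function.Periodic γ (2 * Real.pi)
  pos : ∀ᵐ x, 0 < γ x

/-- An integrable weight with the doubling property `γ(2I) ≤ C γ(I)`, where `I = [a, b]` runs over
the intervals (arcs) of the circle and `2I` has the same midpoint and twice the length. -/
structure IsDoublingWeight (γ : ℝ → ℝ≥0∞) : Prop extends IsWeight γ where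
  integrable : ∫⁻ x in Ioc (-Real.pi) Real.pi, γ x < ∞
  doubling : ∃ C : ℝ≥0, ∀ a b : ℝ, a < b → b ≤ a + 2 * Real.pi →
    ∫⁻ x in Icc (a - (b - a) / 2) (b + (b - a) / 2), γ x ≤ C * ∫⁻ x in Icc a b, γ x

/-- The Muckenhoupt constant `[γ]_p` for `1 < p < ∞`, the supremum being over the intervals `[a, b]`
of the circle (arcs of length at most `2π`). -/
def muckenhouptConst (p : ℝ) (γ : ℝ → ℝ≥0∞) : ℝ≥0∞ :=
  ⨆ (a : ℝ) (b : ℝ) (_ : a < b) (_ : b ≤ a + 2 * Real.pi),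
    ((∫⁻ x in Icc a b, γ x) / ENNReal.ofReal (b - a)) *
      ((∫⁻ x in Icc a b, γ x ^ (-1 / (p - 1))) / ENNReal.ofReal (b - a)) ^ (p - 1)

/-- The constant `[γ]_1`: the supremum of the averages of `γ` over the intervals of the circle. -/
def averageConst (γ : ℝ → ℝ≥0∞) : ℝ≥0∞ :=
  ⨆ (a : ℝ) (b : ℝ) (_ : a < b) (_ : b ≤ a + 2 * Real.pi),
    (∫⁻ x in Icc a b, γ x) / ENNReal.ofReal (b - a)

/-- The Muckenhoupt class `A_p`, `1 < p < ∞`. -/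
def IsMuckenhoupt (p : ℝ) (γ : ℝ → ℝ≥0∞) : Prop :=
  IsDoublingWeight γ ∧ muckenhouptConst p γ < ∞

/-- The class `𝔖₁`: weights with bounded averages which are bounded below by a positive constant. -/
def IsClassS1 (γ : ℝ → ℝ≥0∞) : Prop :=
  IsWeight γ ∧ averageConst γ < ∞ ∧ ∃ c : ℝ≥0, 0 < c ∧ ∀ᵐ x, (c : ℝ≥0∞) ≤ γ x

/-- The class `A𝔖_p¹`, `1 ≤ p ≤ ∞`: the class `𝔖₁` if `p = 1`, the weight `1` if `p = ∞`, and the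
Muckenhoupt class `A_p` if `1 < p < ∞`. -/
def IsClassAS (p : ℝ≥0∞) (γ : ℝ → ℝ≥0∞) : Prop :=
  if p = 1 then IsClassS1 γ
  else if p = ∞ then IsWeight γ ∧ ∀ᵐ x, γ x = 1
  else IsMuckenhoupt p.toReal γ

/-- The constant `[γ]_p` for `1 ≤ p ≤ ∞`, with the value `1` for `p = ∞`. -/
def weightConst (p : ℝ≥0∞) (γ : ℝ → ℝ≥0∞) : ℝ≥0∞ :=
  if p = 1 then averageConst γ
  else if p = ∞ then 1
  else muckenhouptConst p.toReal γ

/-- The measure `γ(x) dx` on one period `(-π, π]`. -/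
def weightedMeasure (γ : ℝ → ℝ≥0∞) : Measure ℝ :=
  (volume.restrict (Ioc (-Real.pi) Real.pi)).withDensity γ

/-- `f ∈ L_{p,γ}`; functions on the circle are `2π`-periodic functions on `ℝ`. -/
def MemWeightedLp (p : ℝ≥0∞) (γ : ℝ → ℝ≥0∞) (f : ℝ → ℝ) : Prop :=
  Function.Periodic f (2 * Real.pi) ∧ MemLp f p (weightedMeasure γ)

/-- The norm `‖f‖_{p,γ}`, with values in `[0, ∞]`. -/
def weightedNorm (p : ℝ≥0∞) (γ : ℝ → ℝ≥0∞) (f : ℝ → ℝ) : ℝ≥0∞ :=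
  eLpNorm f p (weightedMeasure γ)

/-- The one-sided Steklov mean `𝔗_v f(x) = v⁻¹ ∫_x^{x+v} f(s) ds`, with `𝔗_0 f = f`. -/
def steklov (v : ℝ) (f : ℝ → ℝ) : ℝ → ℝ := fun x =>
  if v = 0 then f x else (1 / v) * ∫ s in x..(x + v), f s

/-- The modulus of smoothness `Ω_k(f, v)_{p,γ} = ‖(𝕀 - 𝔗_v)^k f‖_{p,γ}`. -/
def modulus (p : ℝ≥0∞) (γ : ℝ → ℝ≥0∞) (k : ℕ) (f : ℝ → ℝ) (v : ℝ) : ℝ≥0∞ :=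
  weightedNorm p γ ((fun g : ℝ → ℝ => g - steklov v g)^[k] f)

end

/-! Write D_h = I - T_h, let F be a primitive of f, L_h = `steklovMoment h` and R_h = `steklovTail
h`, so T_h = L_h + R_h, each half having kernel mass 1/2. The only property of the weight used in
the Marchaud argument is a uniform bound M for the averages T_v|f| in the norm.

Since L_h f = -(1/h) D_h F, one has L_b D_a = (a/b) L_a D_b, and increments of L_h g are integrals
of D_h g. If u = g - 2 L_h g, then (I - R_h) u = D_h g + (2 R_h - I) L_h g, which is controlled by
D_h g. Iterates of R_h decay like n/2^n times an average, so I - R_h is bounded below and ‖g - 2 L_h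
g‖ ≤ C ‖D_h g‖ (`exists_eLpNorm_sub_two_smul_steklovMoment_le`). Applying this to D_a g with step b
and to D_b g with step a, the L terms cancel: ‖D_a g - (a/b) D_b g‖ ≤ C ‖D_a D_b g‖ for a ≤ b
(`exists_eLpNorm_steklovDiff_sub_le`).

With b = 2a and induction on k this becomes ‖D_a^k g‖ ≤ 2^{-k} ‖D_{2a}^k g‖ + C ‖D_a^{k+1} g‖.
Iterating up to a scale of at least 1/4 gives the integral. There the remaining term is absorbed by
‖g‖ ≤ C ‖D_h g‖ for mean-zero g, which applies because D_h^k f has mean zero when k ≥ 1.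

For p < ∞ the averages are bounded through a one-interval inequality (Hölder for p > 1, the lower
bound of the weight for p = 1) integrated over all positions of the interval. All constants depend
only on p, k and M. -/

/-- The difference `(𝕀 - 𝔗_v) f`. -/
noncomputable def steklovDiff (v : ℝ) (f : ℝ → ℝ) : ℝ → ℝ := f - steklov v f

/-- The primitive of `f` vanishing at `0`. -/
noncomputable def primitive (f : ℝ → ℝ) : ℝ → ℝ := fun x => ∫ s in (0 : ℝ)..x, f s

/-- The mean of `f` over `[x, x + h]` with density `(1 - r)`, `r = (s - x) / h`, written through the
primitive of `f`. -/
noncomputable def steklovMoment (h : ℝ) (f : ℝ → ℝ) : ℝ → ℝ := (-(1 / h)) • steklovDiff h (primitive f)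

/-- The mean of `f` over `[x, x + h]` with density `r = (s - x) / h`. -/
noncomputable def steklovTail (h : ℝ) (f : ℝ → ℝ) : ℝ → ℝ := steklov h f - steklovMoment h f

/-! ### Primitives of locally integrable functions. -/

section Primitive

variable {f g : ℝ → ℝ}

theorem MeasureTheory.LocallyIntegrable.intervalIntegrable_real (hf : LocallyIntegrable f) (a b : ℝ) :
    IntervalIntegrable f volume a b :=
  (hf.integrableOn_isCompact isCompact_uIcc).intervalIntegrable

theorem primitive_sub_primitive (hf : LocallyIntegrable f) (x y : ℝ) :
    primitive f y - primitive f x = ∫ s in x..y, f s :=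
  intervalIntegral.integral_interval_sub_left (hf.intervalIntegrable_real 0 y)
    (hf.intervalIntegrable_real 0 x)

theorem continuous_primitive_of_locallyIntegrable (hf : LocallyIntegrable f) :
    Continuous (primitive f) :=
  intervalIntegral.continuous_primitive hf.intervalIntegrable_real 0

theorem locallyIntegrable_primitive (hf : LocallyIntegrable f) :
    LocallyIntegrable (primitive f) :=
  (continuous_primitive_of_locallyIntegrable hf).locallyIntegrable

theorem locallyIntegrable_abs (hf : LocallyIntegrable f) :
    LocallyIntegrable (fun x => |f x|) :=
  hf.mono hf.aestronglyMeasurable.norm (Filter.Eventually.of_forall fun x => by simp)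

theorem abs_primitive_sub_le (hf : LocallyIntegrable f) {x y : ℝ} (hxy : x ≤ y) :
    |primitive f y - primitive f x| ≤ ∫ s in x..y, |f s| := by
  rw [primitive_sub_primitive hf]
  exact intervalIntegral.abs_integral_le_integral_abs hxy

theorem integral_abs_mono (hf : LocallyIntegrable f) {a b c d : ℝ} (hca : c ≤ a) (hab : a ≤ b)
    (hbd : b ≤ d) : ∫ s in a..b, |f s| ≤ ∫ s in c..d, |f s| :=
  intervalIntegral.integral_mono_interval hca hab hbd
    (Filter.Eventually.of_forall fun _ => abs_nonneg _)
    ((locallyIntegrable_abs hf).intervalIntegrable_real c d)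

end Primitive

/-! ### Algebra and pointwise bounds for the Steklov mean and its two halves. -/

section Steklov

variable {f g : ℝ → ℝ} {h a b : ℝ}

theorem steklov_apply (hh : 0 < h) (f : ℝ → ℝ) (x : ℝ) :
    steklov h f x = (1 / h) * ∫ s in x..(x + h), f s := by
  simp [steklov, hh.ne']

theorem steklov_eq_primitive (hh : 0 < h) (hf : LocallyIntegrable f) (x : ℝ) :
    steklov h f x = (1 / h) * (primitive f (x + h) - primitive f x) := by
  rw [steklov_apply hh, primitive_sub_primitive hf]

theorem continuous_steklov (hh : 0 < h) (hf : LocallyIntegrable f) : Continuous (steklov h f) := by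
  have hc := continuous_primitive_of_locallyIntegrable hf
  rw [show steklov h f = fun x => (1 / h) * (primitive f (x + h) - primitive f x) from
    funext (steklov_eq_primitive hh hf)]
  fun_prop

theorem locallyIntegrable_steklov (hh : 0 < h) (hf : LocallyIntegrable f) :
    LocallyIntegrable (steklov h f) := (continuous_steklov hh hf).locallyIntegrable

theorem locallyIntegrable_steklovDiff (hh : 0 < h) (hf : LocallyIntegrable f) :
    LocallyIntegrable (steklovDiff h f) := hf.sub (locallyIntegrable_steklov hh hf)

theorem steklov_sub (hh : 0 < h) (hf : LocallyIntegrable f) (hg : LocallyIntegrable g) :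
    steklov h (f - g) = steklov h f - steklov h g := by
  ext x
  simp only [steklov_apply hh, Pi.sub_apply]
  rw [intervalIntegral.integral_sub (hf.intervalIntegrable_real _ _)
    (hg.intervalIntegrable_real _ _)]
  ring

theorem steklov_smul (hh : 0 < h) (c : ℝ) (f : ℝ → ℝ) :
    steklov h (c • f) = c • steklov h f := by
  ext x
  simp only [steklov_apply hh, Pi.smul_apply, smul_eq_mul, intervalIntegral.integral_const_mul]
  ring

theorem steklov_const (hh : 0 < h) (c : ℝ) : steklov h (fun _ => c) = fun _ => c := by
  ext x
  simp only [steklov_apply hh, intervalIntegral.integral_const, add_sub_cancel_left, smul_eq_mul]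
  field_simp

theorem integral_shift_primitive (hf : LocallyIntegrable f) (h x y : ℝ) :
    ∫ s in x..y, (primitive f (s + h) - primitive f s) =
      (primitive (primitive f) (y + h) - primitive (primitive f) (x + h)) -
        (primitive (primitive f) y - primitive (primitive f) x) := by
  have hF := locallyIntegrable_primitive hf
  have hc := continuous_primitive_of_locallyIntegrable hf
  rw [intervalIntegral.integral_sub, intervalIntegral.integral_comp_add_right,
    primitive_sub_primitive hF, primitive_sub_primitive hF]
  · exact Continuous.intervalIntegrable (by fun_prop) _ _
  · exact Continuous.intervalIntegrable (by fun_prop) _ _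

theorem integral_steklov (hh : 0 < h) (hf : LocallyIntegrable f) (x y : ℝ) :
    ∫ s in x..y, steklov h f s = steklov h (primitive f) y - steklov h (primitive f) x := by
  have hF := locallyIntegrable_primitive hf
  rw [steklov_eq_primitive hh hF, steklov_eq_primitive hh hF]
  simp only [steklov_eq_primitive hh hf, intervalIntegral.integral_const_mul]
  rw [integral_shift_primitive hf]
  ring

/-- Both sides are 1/(ab) times the mixed second difference, with steps a and b, of the second
primitive of f. -/
theorem steklov_comm (ha : 0 < a) (hb : 0 < b) (hf : LocallyIntegrable f) :
    steklov a (steklov b f) = steklov b (steklov a f) := by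
  have hF := locallyIntegrable_primitive hf
  ext x
  rw [steklov_apply ha, steklov_apply hb, integral_steklov hb hf, integral_steklov ha hf]
  simp only [steklov_eq_primitive ha hF, steklov_eq_primitive hb hF]
  rw [add_right_comm x b a]
  ring

theorem steklovDiff_sub (hh : 0 < h) (hf : LocallyIntegrable f) (hg : LocallyIntegrable g) :
    steklovDiff h (f - g) = steklovDiff h f - steklovDiff h g := by
  simp only [steklovDiff, steklov_sub hh hf hg]
  abel

theorem steklovDiff_smul (hh : 0 < h) (c : ℝ) (f : ℝ → ℝ) :
    steklovDiff h (c • f) = c • steklovDiff h f := by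
  simp only [steklovDiff, steklov_smul hh, smul_sub]

theorem steklovDiff_comm (ha : 0 < a) (hb : 0 < b) (hf : LocallyIntegrable f) :
    steklovDiff a (steklovDiff b f) = steklovDiff b (steklovDiff a f) := by
  have hTa := locallyIntegrable_steklov ha hf
  have hTb := locallyIntegrable_steklov hb hf
  simp only [steklovDiff, steklov_sub ha hf hTb, steklov_sub hb hf hTa, steklov_comm ha hb hf]
  abel

theorem integral_steklovDiff (hh : 0 < h) (hf : LocallyIntegrable f) (x y : ℝ) :
    ∫ s in x..y, steklovDiff h f s =
      steklovDiff h (primitive f) y - steklovDiff h (primitive f) x := by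
  simp only [steklovDiff, Pi.sub_apply]
  rw [intervalIntegral.integral_sub (hf.intervalIntegrable_real _ _)
    ((locallyIntegrable_steklov hh hf).intervalIntegrable_real _ _), integral_steklov hh hf,
    ← primitive_sub_primitive hf]
  ring

theorem primitive_steklovDiff (hh : 0 < h) (hf : LocallyIntegrable f) :
    primitive (steklovDiff h f) =
      steklovDiff h (primitive f) - fun _ => steklovDiff h (primitive f) 0 :=
  funext fun x => integral_steklovDiff hh hf 0 x

theorem steklovDiff_const (hh : 0 < h) (c : ℝ) : steklovDiff h (fun _ => c) = 0 := by
  simp only [steklovDiff, steklov_const hh, sub_self]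

theorem locallyIntegrable_steklovMoment (hh : 0 < h) (hf : LocallyIntegrable f) :
    LocallyIntegrable (steklovMoment h f) :=
  (locallyIntegrable_steklovDiff hh (locallyIntegrable_primitive hf)).smul _

theorem locallyIntegrable_steklovTail (hh : 0 < h) (hf : LocallyIntegrable f) :
    LocallyIntegrable (steklovTail h f) :=
  (locallyIntegrable_steklov hh hf).sub (locallyIntegrable_steklovMoment hh hf)

/-- This is how D_h g controls the oscillation of L_h g, both on one step and over a whole period.
-/
theorem steklovMoment_sub_apply (hh : 0 < h) (hf : LocallyIntegrable f) (x y : ℝ) :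
    steklovMoment h f y - steklovMoment h f x = -(1 / h) * ∫ s in x..y, steklovDiff h f s := by
  rw [integral_steklovDiff hh hf]
  simp only [steklovMoment, Pi.smul_apply, smul_eq_mul]
  ring

/-- The primitive of D_a f is D_a F up to a constant, and D_b kills constants. -/
theorem steklovMoment_steklovDiff (ha : 0 < a) (hb : 0 < b) (hf : LocallyIntegrable f) :
    steklovMoment b (steklovDiff a f) =
      (-(1 / b)) • steklovDiff b (steklovDiff a (primitive f)) := by
  have hF := locallyIntegrable_primitive hf
  rw [steklovMoment, primitive_steklovDiff ha hf,
    steklovDiff_sub hb (locallyIntegrable_steklovDiff ha hF) (locallyIntegrable_const _),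
    steklovDiff_const hb, sub_zero]

/-- D_b D_a F is symmetric in a and b, so only the prefactors 1/a and 1/b differ. This is the
cancellation behind `exists_eLpNorm_steklovDiff_sub_le`. -/
theorem steklovMoment_steklovDiff_swap (ha : 0 < a) (hb : 0 < b) (hf : LocallyIntegrable f) :
    steklovMoment b (steklovDiff a f) = (a / b) • steklovMoment a (steklovDiff b f) := by
  have hF := locallyIntegrable_primitive hf
  rw [steklovMoment_steklovDiff ha hb hf, steklovMoment_steklovDiff hb ha hf,
    steklovDiff_comm hb ha hF, smul_smul]
  congr 1
  field_simp

theorem primitive_sub (hf : LocallyIntegrable f) (hg : LocallyIntegrable g) :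
    primitive (f - g) = primitive f - primitive g :=
  funext fun _ => intervalIntegral.integral_sub (hf.intervalIntegrable_real _ _)
    (hg.intervalIntegrable_real _ _)

theorem primitive_smul (c : ℝ) (f : ℝ → ℝ) : primitive (c • f) = c • primitive f :=
  funext fun _ => intervalIntegral.integral_const_mul _ _

theorem steklovTail_sub (hh : 0 < h) (hf : LocallyIntegrable f) (hg : LocallyIntegrable g) :
    steklovTail h (f - g) = steklovTail h f - steklovTail h g := by
  simp only [steklovTail, steklovMoment, steklov_sub hh hf hg, primitive_sub hf hg,
    steklovDiff_sub hh (locallyIntegrable_primitive hf) (locallyIntegrable_primitive hg), smul_sub]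
  abel

theorem steklovTail_smul (hh : 0 < h) (c : ℝ) (f : ℝ → ℝ) :
    steklovTail h (c • f) = c • steklovTail h f := by
  simp only [steklovTail, steklovMoment, steklov_smul hh, primitive_smul, steklovDiff_smul hh,
    smul_sub]
  rw [smul_comm]

theorem steklovMoment_apply (hh : 0 < h) (hf : LocallyIntegrable f) (x : ℝ) :
    steklovMoment h f x =
      (1 / h ^ 2) * ∫ s in x..(x + h), (primitive f s - primitive f x) := by
  have hF := locallyIntegrable_primitive hf
  rw [intervalIntegral.integral_sub (hF.intervalIntegrable_real _ _) (by simp),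
    intervalIntegral.integral_const]
  simp only [steklovMoment, steklovDiff, Pi.smul_apply, Pi.sub_apply, steklov_apply hh, smul_eq_mul,
    add_sub_cancel_left]
  field_simp
  ring

theorem steklovTail_apply (hh : 0 < h) (hf : LocallyIntegrable f) (x : ℝ) :
    steklovTail h f x =
      (1 / h ^ 2) * ∫ s in x..(x + h), (primitive f (x + h) - primitive f s) := by
  have hF := locallyIntegrable_primitive hf
  rw [intervalIntegral.integral_sub (by simp) (hF.intervalIntegrable_real _ _),
    intervalIntegral.integral_const]
  simp only [steklovTail, steklovMoment, steklovDiff, Pi.smul_apply, Pi.sub_apply,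
    steklov_apply hh (primitive f), steklov_eq_primitive hh hf, smul_eq_mul, add_sub_cancel_left]
  field_simp
  ring

theorem abs_steklov_le (hh : 0 < h) (f : ℝ → ℝ) (x : ℝ) :
    |steklov h f x| ≤ steklov h (fun s => |f s|) x := by
  rw [steklov_apply hh, steklov_apply hh, abs_mul, abs_of_pos (by positivity : 0 < 1 / h)]
  gcongr
  exact intervalIntegral.abs_integral_le_integral_abs (by linarith)

theorem abs_integral_primitive_le (hh : 0 < h) {u : ℝ → ℝ} {B x : ℝ}
    (hu : ∀ s ∈ Icc x (x + h), |u s| ≤ B) :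
    |(1 / h ^ 2) * ∫ s in x..(x + h), u s| ≤ (1 / h) * B := by
  have h1 : ‖∫ s in x..(x + h), u s‖ ≤ B * |x + h - x| :=
    intervalIntegral.norm_integral_le_of_norm_le_const fun s hs => by
      rw [uIoc_of_le (by linarith)] at hs
      exact hu s ⟨hs.1.le, hs.2⟩
  rw [add_sub_cancel_left, abs_of_pos hh, Real.norm_eq_abs] at h1
  rw [abs_mul, abs_of_pos (by positivity : 0 < 1 / h ^ 2)]
  calc (1 / h ^ 2) * |∫ s in x..(x + h), u s| ≤ (1 / h ^ 2) * (B * h) := by gcongr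
    _ = (1 / h) * B := by field_simp

theorem abs_steklovMoment_le (hh : 0 < h) (hf : LocallyIntegrable f) (x : ℝ) :
    |steklovMoment h f x| ≤ steklov h (fun s => |f s|) x := by
  rw [steklovMoment_apply hh hf, steklov_apply hh]
  exact abs_integral_primitive_le hh fun s hs =>
    (abs_primitive_sub_le hf hs.1).trans (integral_abs_mono hf le_rfl hs.1 hs.2)

theorem abs_steklovTail_le (hh : 0 < h) (hf : LocallyIntegrable f) (x : ℝ) :
    |steklovTail h f x| ≤ steklov h (fun s => |f s|) x := by
  rw [steklovTail_apply hh hf, steklov_apply hh]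
  exact abs_integral_primitive_le hh fun s hs =>
    (abs_primitive_sub_le hf hs.2).trans (integral_abs_mono hf hs.1 hs.2 le_rfl)

/-- The kernel r on [0, 1] has mass 1/2. This gain per application is what makes the iterates decay.
-/
theorem abs_steklovTail_le_half (hh : 0 < h) (hf : LocallyIntegrable f) {x B : ℝ}
    (hB : ∀ s ∈ Icc x (x + h), |f s| ≤ B) : |steklovTail h f x| ≤ B / 2 := by
  have hF := continuous_primitive_of_locallyIntegrable hf
  have h1 : |∫ s in x..(x + h), (primitive f (x + h) - primitive f s)| ≤
      ∫ s in x..(x + h), B * (x + h - s) := by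
    refine (intervalIntegral.abs_integral_le_integral_abs (by linarith)).trans
      (intervalIntegral.integral_mono_on (by linarith)
        (Continuous.intervalIntegrable (by fun_prop) _ _)
        (Continuous.intervalIntegrable (by fun_prop) _ _) fun s hs => ?_)
    rw [primitive_sub_primitive hf]
    have := intervalIntegral.norm_integral_le_of_norm_le_const (a := s) (b := x + h) (f := f)
      (C := B) fun r hr => by
        rw [uIoc_of_le hs.2] at hr
        exact hB r ⟨hs.1.trans hr.1.le, hr.2⟩
    rwa [Real.norm_eq_abs, abs_of_nonneg (sub_nonneg.2 hs.2)] at this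
  have h2 : ∫ s in x..(x + h), B * (x + h - s) = B * h ^ 2 / 2 := by
    rw [intervalIntegral.integral_const_mul,
      intervalIntegral.integral_comp_sub_left (fun r => r) (x + h)]
    simp
    ring
  rw [steklovTail_apply hh hf, abs_mul, abs_of_pos (by positivity : 0 < 1 / h ^ 2)]
  calc (1 / h ^ 2) * |∫ s in x..(x + h), (primitive f (x + h) - primitive f s)|
      ≤ (1 / h ^ 2) * (B * h ^ 2 / 2) := by rw [← h2]; gcongr
    _ = B / 2 := by field_simp

theorem steklovTail_const (hh : 0 < h) (c x : ℝ) : steklovTail h (fun _ => c) x = c / 2 := by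
  rw [steklovTail_apply hh (locallyIntegrable_const c)]
  simp only [primitive, intervalIntegral.integral_const, smul_eq_mul, sub_zero]
  have : ∀ s : ℝ, (x + h) * c - s * c = c * (x + h - s) := fun s => by ring
  simp only [this]
  rw [intervalIntegral.integral_const_mul,
    intervalIntegral.integral_comp_sub_left (fun r => r) (x + h)]
  simp
  field_simp

/-- Twice the tail is a genuine average (kernel mass 1), so it differs from f x by at most the
oscillation of f. -/
theorem abs_two_mul_steklovTail_sub_le (hh : 0 < h) (hf : LocallyIntegrable f) {x B : ℝ}
    (hB : ∀ s ∈ Icc x (x + h), |f s - f x| ≤ B) : |2 * steklovTail h f x - f x| ≤ B := by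
  have h1 := abs_steklovTail_le_half hh (hf.sub (locallyIntegrable_const (f x))) (x := x) (B := B)
    fun s hs => hB s hs
  rw [steklovTail_sub hh hf (locallyIntegrable_const _), Pi.sub_apply, steklovTail_const hh] at h1
  rw [abs_le] at h1 ⊢
  constructor <;> linarith [h1.1, h1.2]

theorem locallyIntegrable_iterate_steklovTail (hh : 0 < h) (hf : LocallyIntegrable f) (n : ℕ) :
    LocallyIntegrable ((steklovTail h)^[n] f) := by
  induction n with
  | zero => exact hf
  | succ n ih =>
    rw [Function.iterate_succ_apply']
    exact locallyIntegrable_steklovTail hh ih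

/-- The first application bounds the value by an integral of |f|. Each of the other n gains a factor
1/2 while the window grows by h; the factor n + 1 comes from normalising by the final window length.
-/
theorem abs_iterate_steklovTail_le (hh : 0 < h) (hf : LocallyIntegrable f) (n : ℕ) (x : ℝ) :
    |(steklovTail h)^[n + 1] f x| ≤
      ((n + 1) / 2 ^ n) * steklov ((n + 1) * h) (fun s => |f s|) x := by
  have key : ∀ n : ℕ, ∀ x, |(steklovTail h)^[n + 1] f x| ≤
      (1 / 2 ^ n) * ((1 / h) * ∫ s in x..(x + (n + 1) * h), |f s|) := by
    intro n
    induction n with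
    | zero =>
      intro x
      simpa [steklov_apply hh] using abs_steklovTail_le hh hf x
    | succ n ih =>
      intro x
      rw [Function.iterate_succ_apply']
      refine (abs_steklovTail_le_half hh (locallyIntegrable_iterate_steklovTail hh hf (n + 1))
        (B := (1 / 2 ^ n) * ((1 / h) * ∫ s in x..(x + ((n + 1 : ℕ) + 1) * h), |f s|))
        fun s hs => (ih s).trans ?_).trans_eq (by rw [pow_succ]; ring)
      gcongr
      refine integral_abs_mono hf hs.1 ?_ ?_
      · have : (0 : ℝ) ≤ (n + 1) * h := by positivity
        linarith
      · push_cast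
        linarith [hs.2]
  refine (key n x).trans_eq ?_
  rw [steklov_apply (by positivity)]
  field_simp

end Steklov

/-! ### Periodicity and functions of mean zero. -/

section Periodic

variable {f g : ℝ → ℝ} {h a b T : ℝ}

theorem periodic_steklov (hh : 0 < h) (hp : Function.Periodic f T) :
    Function.Periodic (steklov h f) T := by
  intro x
  rw [steklov_apply hh, steklov_apply hh, add_right_comm,
    ← intervalIntegral.integral_comp_add_right]
  simp only [hp _]

theorem periodic_steklovMoment (hh : 0 < h) (hf : LocallyIntegrable f)
    (hp : Function.Periodic f T) : Function.Periodic (steklovMoment h f) T := by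
  intro x
  rw [steklovMoment_apply hh hf, steklovMoment_apply hh hf, add_right_comm,
    ← intervalIntegral.integral_comp_add_right]
  congr 1
  refine intervalIntegral.integral_congr fun s _ => ?_
  simp only [primitive_sub_primitive hf]
  rw [← intervalIntegral.integral_comp_add_right]
  simp only [hp _]

theorem periodic_steklovTail (hh : 0 < h) (hf : LocallyIntegrable f)
    (hp : Function.Periodic f T) : Function.Periodic (steklovTail h f) T :=
  (periodic_steklov hh hp).sub (periodic_steklovMoment hh hf hp)

theorem steklov_period (hT : 0 < T) (hp : Function.Periodic f T) :
    steklov T f = fun _ => steklov T f 0 := by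
  ext x
  rw [steklov_apply hT, steklov_apply hT, hp.intervalIntegral_add_eq x 0]

theorem steklov_period_steklovDiff (hT : 0 < T) (hh : 0 < h) (hf : LocallyIntegrable f)
    (hp : Function.Periodic f T) : steklov T (steklovDiff h f) = 0 := by
  rw [steklovDiff, steklov_sub hT hf (locallyIntegrable_steklov hh hf), steklov_comm hT hh hf,
    steklov_period hT hp, steklov_const hh, sub_self]

/-- A mean-zero f has a periodic primitive, and D_h of a periodic function has mean zero. -/
theorem steklov_period_steklovMoment (hT : 0 < T) (hh : 0 < h) (hf : LocallyIntegrable f)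
    (hf0 : steklov T f = 0) : steklov T (steklovMoment h f) = 0 := by
  have hF : Function.Periodic (primitive f) T := fun x => by
    have := congrFun hf0 x
    rw [steklov_eq_primitive hT hf, Pi.zero_apply] at this
    have h2 := (mul_eq_zero.1 this).resolve_left (by positivity)
    linarith
  rw [steklovMoment, steklov_smul hT,
    steklov_period_steklovDiff hT hh (locallyIntegrable_primitive hf) hF, smul_zero]

theorem abs_steklovMoment_le_of_mean_zero (hT : 0 < T) (hh : 0 < h) (hf : LocallyIntegrable f)
    (hf0 : steklov T f = 0) (x : ℝ) :
    |steklovMoment h f x| ≤ (T / h) * steklov T (fun s => |steklovDiff h f s|) x := by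
  have hD := locallyIntegrable_steklovDiff hh hf
  have hL := locallyIntegrable_steklovMoment hh hf
  have h0 := congrFun (steklov_period_steklovMoment hT hh hf hf0) x
  -- Having mean zero, the function equals at x minus the mean of its increments from x, and those
  -- are integrals of D_h f.
  have h1 : steklovMoment h f x =
      -steklov T (steklovMoment h f - fun _ => steklovMoment h f x) x := by
    rw [steklov_sub hT hL (locallyIntegrable_const _), steklov_const hT, Pi.sub_apply, h0]
    simp
  rw [h1, abs_neg, steklov_apply hT, steklov_apply hT, abs_mul,
    abs_of_pos (by positivity : 0 < 1 / T)]
  have h2 := intervalIntegral.norm_integral_le_of_norm_le_const (a := x) (b := x + T)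
    (f := steklovMoment h f - fun _ => steklovMoment h f x)
    (C := (1 / h) * ∫ s in x..(x + T), |steklovDiff h f s|) fun y hy => by
      rw [uIoc_of_le (by linarith)] at hy
      rw [Pi.sub_apply, steklovMoment_sub_apply hh hf, Real.norm_eq_abs, abs_mul, abs_neg,
        abs_of_pos (by positivity : 0 < 1 / h)]
      gcongr
      exact (intervalIntegral.abs_integral_le_integral_abs hy.1.le).trans
        (integral_abs_mono hD le_rfl hy.1.le hy.2)
  rw [add_sub_cancel_left, abs_of_pos hT, Real.norm_eq_abs] at h2
  calc _ ≤ 1 / T * ((1 / h * ∫ s in x..(x + T), |steklovDiff h f s|) * T) := by gcongr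
    _ = _ := by field_simp

end Periodic

/-- Uniform boundedness, with constant `M`, of the Steklov means of `|f|` in `L_p(ν)`. -/
structure SteklovBound (p : ℝ≥0∞) (ν : Measure ℝ) (M : ℝ≥0) : Prop where
  absolutelyContinuous : ν ≪ volume
  eLpNorm_le : ∀ f : ℝ → ℝ, LocallyIntegrable f → Function.Periodic f (2 * Real.pi) →
    ∀ v : ℝ, 0 < v → eLpNorm (steklov v fun s => |f s|) p ν ≤ M * eLpNorm f p ν

/-- Periodic locally integrable functions of finite `L_p(ν)` norm. -/
structure IsPeriodicLp (p : ℝ≥0∞) (ν : Measure ℝ) (f : ℝ → ℝ) : Prop where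
  periodic : Function.Periodic f (2 * Real.pi)
  locallyIntegrable : LocallyIntegrable f
  ne_top : eLpNorm f p ν ≠ ∞

/-! ### Norm estimates: bounding I - R_h below and comparing two steps. -/

section Norm

variable {p : ℝ≥0∞} {ν : Measure ℝ} {M : ℝ≥0} {f g : ℝ → ℝ} {h a b : ℝ}

theorem SteklovBound.aestronglyMeasurable (hν : SteklovBound p ν M) (hf : LocallyIntegrable f) :
    AEStronglyMeasurable f ν :=
  hf.aestronglyMeasurable.mono_ac hν.absolutelyContinuous

theorem SteklovBound.norm_le (hν : SteklovBound p ν M) (hf : LocallyIntegrable f)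
    (hp : Function.Periodic f (2 * Real.pi)) {v : ℝ} (hv : 0 < v) (c : ℝ≥0)
    (hg : ∀ x, |g x| ≤ c * steklov v (fun s => |f s|) x) :
    eLpNorm g p ν ≤ c * M * eLpNorm f p ν := by
  have h1 := eLpNorm_le_nnreal_smul_eLpNorm_of_ae_le_mul (μ := ν) (f := g)
    (g := steklov v fun s => |f s|) (c := c) (Filter.Eventually.of_forall fun x => by
      rw [← NNReal.coe_le_coe, NNReal.coe_mul, coe_nnnorm, coe_nnnorm, Real.norm_eq_abs]
      exact (hg x).trans (by gcongr; exact le_abs_self _)) p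
  rw [mul_assoc]
  refine h1.trans ?_
  rw [ENNReal.smul_def, smul_eq_mul]
  gcongr
  exact hν.eLpNorm_le f hf hp v hv

theorem SteklovBound.norm_le' (hν : SteklovBound p ν M) (hf : LocallyIntegrable f)
    (hp : Function.Periodic f (2 * Real.pi)) {v : ℝ} (hv : 0 < v)
    (hg : ∀ x, |g x| ≤ steklov v (fun s => |f s|) x) :
    eLpNorm g p ν ≤ M * eLpNorm f p ν := by
  simpa using hν.norm_le hf hp hv 1 (by simpa using hg)

theorem SteklovBound.sub_le (hν : SteklovBound p ν M) (hp : 1 ≤ p) (hf : LocallyIntegrable f)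
    (hg : LocallyIntegrable g) : eLpNorm (f - g) p ν ≤ eLpNorm f p ν + eLpNorm g p ν :=
  eLpNorm_sub_le (hν.aestronglyMeasurable hf) (hν.aestronglyMeasurable hg) hp

theorem SteklovBound.add_le (hν : SteklovBound p ν M) (hp : 1 ≤ p) (hf : LocallyIntegrable f)
    (hg : LocallyIntegrable g) : eLpNorm (f + g) p ν ≤ eLpNorm f p ν + eLpNorm g p ν :=
  eLpNorm_add_le (hν.aestronglyMeasurable hf) (hν.aestronglyMeasurable hg) hp

theorem eLpNorm_nnreal_smul (c : ℝ≥0) (f : ℝ → ℝ) :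
    eLpNorm ((c : ℝ) • f) p ν = c * eLpNorm f p ν := by
  rw [eLpNorm_const_smul]
  simp [enorm_eq_nnnorm]

namespace IsPeriodicLp

theorem sub (hν : SteklovBound p ν M) (hp : 1 ≤ p) (hf : IsPeriodicLp p ν f)
    (hg : IsPeriodicLp p ν g) : IsPeriodicLp p ν (f - g) :=
  ⟨hf.periodic.sub hg.periodic, hf.locallyIntegrable.sub hg.locallyIntegrable,
    ne_top_of_le_ne_top (ENNReal.add_ne_top.2 ⟨hf.ne_top, hg.ne_top⟩)
      (hν.sub_le hp hf.locallyIntegrable hg.locallyIntegrable)⟩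

theorem smul (c : ℝ≥0) (hf : IsPeriodicLp p ν f) : IsPeriodicLp p ν ((c : ℝ) • f) :=
  ⟨hf.periodic.smul _, hf.locallyIntegrable.smul _, by
    rw [eLpNorm_nnreal_smul]
    exact ENNReal.mul_ne_top ENNReal.coe_ne_top hf.ne_top⟩

theorem eLpNorm_steklov_le (hν : SteklovBound p ν M) (hh : 0 < h) (hf : IsPeriodicLp p ν f) :
    eLpNorm (_root_.steklov h f) p ν ≤ M * eLpNorm f p ν :=
  hν.norm_le' hf.locallyIntegrable hf.periodic hh (abs_steklov_le hh f)

theorem eLpNorm_steklovMoment_le (hν : SteklovBound p ν M) (hh : 0 < h)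
    (hf : IsPeriodicLp p ν f) : eLpNorm (_root_.steklovMoment h f) p ν ≤ M * eLpNorm f p ν :=
  hν.norm_le' hf.locallyIntegrable hf.periodic hh (abs_steklovMoment_le hh hf.locallyIntegrable)

theorem eLpNorm_steklovTail_le (hν : SteklovBound p ν M) (hh : 0 < h)
    (hf : IsPeriodicLp p ν f) : eLpNorm (_root_.steklovTail h f) p ν ≤ M * eLpNorm f p ν :=
  hν.norm_le' hf.locallyIntegrable hf.periodic hh (abs_steklovTail_le hh hf.locallyIntegrable)

theorem eLpNorm_steklovDiff_le (hν : SteklovBound p ν M) (hp : 1 ≤ p) (hh : 0 < h)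
    (hf : IsPeriodicLp p ν f) :
    eLpNorm (_root_.steklovDiff h f) p ν ≤ (1 + M : ℝ≥0) * eLpNorm f p ν := by
  refine (hν.sub_le hp hf.locallyIntegrable
    (locallyIntegrable_steklov hh hf.locallyIntegrable)).trans ?_
  rw [ENNReal.coe_add, ENNReal.coe_one, add_mul, one_mul]
  gcongr
  exact eLpNorm_steklov_le hν hh hf

theorem steklov (hν : SteklovBound p ν M) (hh : 0 < h) (hf : IsPeriodicLp p ν f) :
    IsPeriodicLp p ν (steklov h f) :=
  ⟨periodic_steklov hh hf.periodic, locallyIntegrable_steklov hh hf.locallyIntegrable,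
    ne_top_of_le_ne_top (ENNReal.mul_ne_top ENNReal.coe_ne_top hf.ne_top)
      (eLpNorm_steklov_le hν hh hf)⟩

theorem steklovMoment (hν : SteklovBound p ν M) (hh : 0 < h) (hf : IsPeriodicLp p ν f) :
    IsPeriodicLp p ν (steklovMoment h f) :=
  ⟨periodic_steklovMoment hh hf.locallyIntegrable hf.periodic,
    locallyIntegrable_steklovMoment hh hf.locallyIntegrable,
    ne_top_of_le_ne_top (ENNReal.mul_ne_top ENNReal.coe_ne_top hf.ne_top)
      (eLpNorm_steklovMoment_le hν hh hf)⟩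

theorem steklovTail (hν : SteklovBound p ν M) (hh : 0 < h) (hf : IsPeriodicLp p ν f) :
    IsPeriodicLp p ν (steklovTail h f) :=
  ⟨periodic_steklovTail hh hf.locallyIntegrable hf.periodic,
    locallyIntegrable_steklovTail hh hf.locallyIntegrable,
    ne_top_of_le_ne_top (ENNReal.mul_ne_top ENNReal.coe_ne_top hf.ne_top)
      (eLpNorm_steklovTail_le hν hh hf)⟩

theorem steklovDiff (hν : SteklovBound p ν M) (hp : 1 ≤ p) (hh : 0 < h)
    (hf : IsPeriodicLp p ν f) : IsPeriodicLp p ν (steklovDiff h f) :=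
  hf.sub hν hp (hf.steklov hν hh)

theorem iterate_steklovDiff (hν : SteklovBound p ν M) (hp : 1 ≤ p) (hh : 0 < h)
    (hf : IsPeriodicLp p ν f) (m : ℕ) : IsPeriodicLp p ν ((_root_.steklovDiff h)^[m] f) := by
  induction m with
  | zero => exact hf
  | succ m ih =>
    rw [Function.iterate_succ_apply']
    exact ih.steklovDiff hν hp hh

theorem iterate_steklovTail (hν : SteklovBound p ν M) (hh : 0 < h)
    (hf : IsPeriodicLp p ν f) (m : ℕ) : IsPeriodicLp p ν ((_root_.steklovTail h)^[m] f) := by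
  induction m with
  | zero => exact hf
  | succ m ih =>
    rw [Function.iterate_succ_apply']
    exact ih.steklovTail hν hh

end IsPeriodicLp

/-- Telescoping: I - R^{m+1} = (I - R) + R (I - R^m). -/
theorem exists_eLpNorm_sub_iterate_steklovTail_le (p : ℝ≥0∞) (hp : 1 ≤ p) (M : ℝ≥0) (m : ℕ) :
    ∃ S : ℝ≥0, ∀ ν, SteklovBound p ν M → ∀ h : ℝ, 0 < h → ∀ g, IsPeriodicLp p ν g →
      eLpNorm (g - (steklovTail h)^[m] g) p ν ≤ S * eLpNorm (g - steklovTail h g) p ν := by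
  induction m with
  | zero => exact ⟨0, fun ν _ h _ g _ => by simp⟩
  | succ m ih =>
    obtain ⟨S, hS⟩ := ih
    refine ⟨1 + M * S, fun ν hν h hh g hg => ?_⟩
    have hgm := hg.iterate_steklovTail hν hh m
    have hd := hg.sub hν hp hgm
    have h1 : g - (steklovTail h)^[m + 1] g =
        (g - steklovTail h g) + steklovTail h (g - (steklovTail h)^[m] g) := by
      rw [Function.iterate_succ_apply', steklovTail_sub hh hg.locallyIntegrable
        hgm.locallyIntegrable]
      abel
    rw [h1]
    refine (hν.add_le hp (hg.sub hν hp (hg.steklovTail hν hh)).locallyIntegrable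
      (hd.steklovTail hν hh).locallyIntegrable).trans ?_
    push_cast
    rw [add_mul, one_mul, mul_assoc]
    gcongr
    refine (hd.eLpNorm_steklovTail_le hν hh).trans ?_
    gcongr
    exact hS ν hν h hh g hg

/-- R_h itself need not be a contraction, since M may be large, but a high power is. Finiteness of
the norm of g allows half of it to be absorbed on the left. -/
theorem exists_eLpNorm_le_sub_steklovTail (p : ℝ≥0∞) (hp : 1 ≤ p) (M : ℝ≥0) :
    ∃ C : ℝ≥0, ∀ ν, SteklovBound p ν M → ∀ h : ℝ, 0 < h → ∀ g, IsPeriodicLp p ν g →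
      eLpNorm g p ν ≤ C * eLpNorm (g - steklovTail h g) p ν := by
  -- n depends on M alone, which keeps the final constant uniform in ν and h.
  obtain ⟨n, hn⟩ : ∃ n : ℕ, ((n + 1) / 2 ^ n : ℝ≥0) * M ≤ 1 / 2 := by
    have h1 := tendsto_pow_const_div_const_pow_of_one_lt 1 (one_lt_two (α := ℝ))
    have h0 := tendsto_pow_const_div_const_pow_of_one_lt 0 (one_lt_two (α := ℝ))
    have h2 := ((h1.add h0).mul_const (M : ℝ)).eventually_le_const
      (show (0 + 0) * (M : ℝ) < 1 / 2 by norm_num)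
    obtain ⟨n, hn⟩ := h2.exists
    refine ⟨n, ?_⟩
    rw [← NNReal.coe_le_coe]
    push_cast
    rw [add_div]
    simpa using hn
  obtain ⟨S, hS⟩ := exists_eLpNorm_sub_iterate_steklovTail_le p hp M (n + 1)
  refine ⟨2 * S, fun ν hν h hh g hg => ?_⟩
  have hgn := hg.iterate_steklovTail hν hh (n + 1)
  have h1 : eLpNorm ((steklovTail h)^[n + 1] g) p ν ≤ (1 / 2 : ℝ≥0) * eLpNorm g p ν := by
    refine (hν.norm_le hg.locallyIntegrable hg.periodic (v := (n + 1) * h) (by positivity)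
      ((n + 1) / 2 ^ n : ℝ≥0) fun x => ?_).trans ?_
    · push_cast
      exact abs_iterate_steklovTail_le hh hg.locallyIntegrable n x
    · rw [← ENNReal.coe_mul]
      gcongr
  have h2 := hν.add_le hp (hg.sub hν hp hgn).locallyIntegrable hgn.locallyIntegrable
  rw [sub_add_cancel] at h2
  replace h2 := h2.trans (add_le_add (hS ν hν h hh g hg) h1)
  by_cases htop : eLpNorm (g - steklovTail h g) p ν = ∞
  -- In `ℝ≥0∞` one has 0 * ∞ = 0, so S = 0 needs its own argument: then ‖g‖ ≤ ‖g‖ / 2 forces ‖g‖ =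
  -- 0.
  · rcases eq_or_ne S 0 with rfl | hS0
    · rw [ENNReal.coe_zero, zero_mul, zero_add] at h2
      have := hg.ne_top
      lift eLpNorm g p ν to ℝ≥0 using this with N
      norm_cast at h2
      have : N = 0 := by
        rw [← NNReal.coe_le_coe] at h2
        push_cast at h2
        have := N.coe_nonneg
        exact NNReal.coe_eq_zero.1 (by linarith)
      simp [this]
    · rw [htop, ENNReal.mul_top (by simpa using hS0)]
      exact le_top
  · have := hg.ne_top
    lift eLpNorm g p ν to ℝ≥0 using this with N
    lift eLpNorm (g - steklovTail h g) p ν to ℝ≥0 using htop with R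
    norm_cast at h2 ⊢
    rw [← NNReal.coe_le_coe] at h2 ⊢
    push_cast at h2 ⊢
    linarith

theorem sub_two_smul_steklovMoment_sub_steklovTail (hh : 0 < h) (hg : LocallyIntegrable g) :
    (g - (2 : ℝ) • steklovMoment h g) - steklovTail h (g - (2 : ℝ) • steklovMoment h g) =
      steklovDiff h g +
        ((2 : ℝ) • steklovTail h (steklovMoment h g) - steklovMoment h g) := by
  have hm := locallyIntegrable_steklovMoment hh hg
  rw [steklovTail_sub hh hg (hm.smul _), steklovTail_smul hh]
  ext x
  simp only [steklovTail, steklovDiff, Pi.sub_apply, Pi.add_apply, Pi.smul_apply, smul_eq_mul]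
  ring

/-- By the preceding identity, I - R_h maps g - 2 L_h g to D_h g plus the error made by replacing
L_h g by its average 2 R_h L_h g. On [x, x + h] the oscillation of L_h g is at most T_h |D_h g| (x).
-/
theorem exists_eLpNorm_sub_two_smul_steklovMoment_le (p : ℝ≥0∞) (hp : 1 ≤ p) (M : ℝ≥0) :
    ∃ C : ℝ≥0, ∀ ν, SteklovBound p ν M → ∀ h : ℝ, 0 < h → ∀ g, IsPeriodicLp p ν g →
      eLpNorm (g - (2 : ℝ) • steklovMoment h g) p ν ≤ C * eLpNorm (steklovDiff h g) p ν := by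
  obtain ⟨C, hC⟩ := exists_eLpNorm_le_sub_steklovTail p hp M
  refine ⟨C * (1 + M), fun ν hν h hh g hg => ?_⟩
  have hm := hg.steklovMoment hν hh
  have hD := hg.steklovDiff hν hp hh
  have hu : IsPeriodicLp p ν (g - (2 : ℝ) • steklovMoment h g) :=
    hg.sub hν hp (by simpa using hm.smul 2)
  refine (hC ν hν h hh _ hu).trans ?_
  rw [sub_two_smul_steklovMoment_sub_steklovTail hh hg.locallyIntegrable, ENNReal.coe_mul,
    mul_assoc]
  gcongr
  refine (hν.add_le hp hD.locallyIntegrable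
    (((hm.steklovTail hν hh).locallyIntegrable.smul (2 : ℝ)).sub hm.locallyIntegrable)).trans ?_
  rw [ENNReal.coe_add, ENNReal.coe_one, add_mul, one_mul]
  gcongr
  refine hν.norm_le' hD.locallyIntegrable hD.periodic hh fun x => ?_
  simp only [Pi.sub_apply, Pi.smul_apply, smul_eq_mul]
  refine abs_two_mul_steklovTail_sub_le hh hm.locallyIntegrable fun s hs => ?_
  rw [steklovMoment_sub_apply hh hg.locallyIntegrable, abs_mul, abs_neg,
    abs_of_pos (by positivity : 0 < 1 / h), steklov_apply hh]
  gcongr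
  exact (intervalIntegral.abs_integral_le_integral_abs hs.1).trans
    (integral_abs_mono hD.locallyIntegrable le_rfl hs.1 hs.2)

theorem exists_eLpNorm_steklovDiff_sub_le (p : ℝ≥0∞) (hp : 1 ≤ p) (M : ℝ≥0) :
    ∃ C : ℝ≥0, ∀ ν, SteklovBound p ν M → ∀ a b : ℝ, 0 < a → a ≤ b → ∀ g, IsPeriodicLp p ν g →
      eLpNorm (steklovDiff a g - (a / b) • steklovDiff b g) p ν ≤
        C * eLpNorm (steklovDiff a (steklovDiff b g)) p ν := by
  obtain ⟨C, hC⟩ := exists_eLpNorm_sub_two_smul_steklovMoment_le p hp M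
  refine ⟨2 * C, fun ν hν a b ha hab g hg => ?_⟩
  have hb := ha.trans_le hab
  have hDa := hg.steklovDiff hν hp ha
  have hDb := hg.steklovDiff hν hp hb
  set X := steklovDiff a g - (2 : ℝ) • steklovMoment b (steklovDiff a g) with hX
  set Y := steklovDiff b g - (2 : ℝ) • steklovMoment a (steklovDiff b g) with hY
  have hXl : LocallyIntegrable X :=
    hDa.locallyIntegrable.sub ((hDa.steklovMoment hν hb).locallyIntegrable.smul _)
  have hYl : LocallyIntegrable Y :=
    hDb.locallyIntegrable.sub ((hDb.steklovMoment hν ha).locallyIntegrable.smul _)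
  -- The L terms of X and (a/b) Y coincide by the swap identity, while X and Y are each bounded by
  -- ‖D_a D_b g‖.
  have h1 : steklovDiff a g - (a / b) • steklovDiff b g = X - (a / b) • Y := by
    rw [hX, hY, steklovMoment_steklovDiff_swap ha hb hg.locallyIntegrable]
    ext x
    simp only [Pi.sub_apply, Pi.smul_apply, smul_eq_mul]
    ring
  have hXn := hC ν hν b hb _ hDa
  have hYn := hC ν hν a ha _ hDb
  rw [steklovDiff_comm hb ha hg.locallyIntegrable, ← hX] at hXn
  rw [← hY] at hYn
  have h2 : eLpNorm ((a / b) • Y) p ν ≤ eLpNorm Y p ν := by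
    rw [eLpNorm_const_smul]
    refine mul_le_of_le_one_left' ?_
    rw [Real.enorm_eq_ofReal (by positivity), ENNReal.ofReal_le_one]
    exact div_le_one_of_le₀ hab hb.le
  rw [h1]
  refine (hν.sub_le hp hXl (hYl.smul _)).trans ((add_le_add hXn (h2.trans hYn)).trans_eq ?_)
  push_cast
  ring

end Norm

/-! ### Powers of D_h, the halving inequality and dyadic summation. -/

section Powers

variable {p : ℝ≥0∞} {ν : Measure ℝ} {M : ℝ≥0} {f g : ℝ → ℝ} {h a b : ℝ}

theorem locallyIntegrable_iterate_steklovDiff (hh : 0 < h) (hf : LocallyIntegrable f) (m : ℕ) :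
    LocallyIntegrable ((steklovDiff h)^[m] f) := by
  induction m with
  | zero => exact hf
  | succ m ih =>
    rw [Function.iterate_succ_apply']
    exact locallyIntegrable_steklovDiff hh ih

theorem iterate_steklovDiff_comm (ha : 0 < a) (hb : 0 < b) (hf : LocallyIntegrable f) (m : ℕ) :
    (steklovDiff b)^[m] (steklovDiff a f) = steklovDiff a ((steklovDiff b)^[m] f) := by
  induction m with
  | zero => rfl
  | succ m ih =>
    rw [Function.iterate_succ_apply', ih, Function.iterate_succ_apply',
      steklovDiff_comm hb ha (locallyIntegrable_iterate_steklovDiff hb hf m)]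

theorem eLpNorm_iterate_steklovDiff_le (hν : SteklovBound p ν M) (hp : 1 ≤ p) (ha : 0 < a)
    (hb : 0 < b) {C : ℝ≥0}
    (hC : ∀ g, IsPeriodicLp p ν g →
      eLpNorm (steklovDiff a g) p ν ≤ C * eLpNorm (steklovDiff b g) p ν)
    (m : ℕ) (hg : IsPeriodicLp p ν g) :
    eLpNorm ((steklovDiff a)^[m] g) p ν ≤
      (C ^ m : ℝ≥0) * eLpNorm ((steklovDiff b)^[m] g) p ν := by
  induction m generalizing g with
  | zero => simp
  | succ m ih =>
    rw [Function.iterate_succ_apply]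
    refine (ih (hg.steklovDiff hν hp ha)).trans ?_
    rw [iterate_steklovDiff_comm ha hb hg.locallyIntegrable, pow_succ, ENNReal.coe_mul, mul_assoc,
      Function.iterate_succ_apply']
    gcongr
    exact hC _ (hg.iterate_steklovDiff hν hp hb m)

/-- In ‖D_a D_b g‖ either factor can be dropped at the cost of 1 + M, so each of D_a g and D_b g
controls the other; b ≤ 2a bounds the ratio b/a. -/
theorem exists_eLpNorm_steklovDiff_le_of_le (p : ℝ≥0∞) (hp : 1 ≤ p) (M : ℝ≥0) :
    ∃ C : ℝ≥0, ∀ ν, SteklovBound p ν M → ∀ a b : ℝ, 0 < a → a ≤ b → b ≤ 2 * a →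
      ∀ g, IsPeriodicLp p ν g →
        eLpNorm (steklovDiff a g) p ν ≤ C * eLpNorm (steklovDiff b g) p ν ∧
        eLpNorm (steklovDiff b g) p ν ≤ C * eLpNorm (steklovDiff a g) p ν := by
  obtain ⟨C, hC⟩ := exists_eLpNorm_steklovDiff_sub_le p hp M
  refine ⟨2 * (1 + C * (1 + M)), fun ν hν a b ha hab hba g hg => ?_⟩
  have hb := ha.trans_le hab
  have hDa := hg.steklovDiff hν hp ha
  have hDb := hg.steklovDiff hν hp hb
  have hK := hC ν hν a b ha hab g hg
  have hKb := hK.trans (mul_le_mul_right (hDb.eLpNorm_steklovDiff_le hν hp ha) _)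
  rw [steklovDiff_comm ha hb hg.locallyIntegrable] at hK
  have hKa := hK.trans (mul_le_mul_right (hDa.eLpNorm_steklovDiff_le hν hp hb) _)
  constructor
  · have h1 : steklovDiff a g =
        (steklovDiff a g - (a / b) • steklovDiff b g) + (a / b) • steklovDiff b g := by abel
    have h2 : eLpNorm ((a / b) • steklovDiff b g) p ν ≤ eLpNorm (steklovDiff b g) p ν := by
      rw [eLpNorm_const_smul]
      refine mul_le_of_le_one_left' ?_
      rw [Real.enorm_eq_ofReal (by positivity), ENNReal.ofReal_le_one]
      exact div_le_one_of_le₀ hab hb.le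
    calc eLpNorm (steklovDiff a g) p ν
        ≤ C * ((1 + M : ℝ≥0) * eLpNorm (steklovDiff b g) p ν) + eLpNorm (steklovDiff b g) p ν := by
          conv_lhs => rw [h1]
          exact (hν.add_le hp (hDa.locallyIntegrable.sub (hDb.locallyIntegrable.smul _))
            (hDb.locallyIntegrable.smul _)).trans (add_le_add hKb h2)
      _ = ((1 + C * (1 + M) : ℝ≥0) : ℝ≥0∞) * eLpNorm (steklovDiff b g) p ν := by push_cast; ring
      _ ≤ _ := by
          gcongr
          exact le_mul_of_one_le_left' one_le_two
  · have h1 : steklovDiff b g =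
        (b / a) • (steklovDiff a g - (steklovDiff a g - (a / b) • steklovDiff b g)) := by
      rw [sub_sub_cancel, smul_smul]
      field_simp
      simp
    have h3 : ‖b / a‖ₑ ≤ 2 := by
      rw [Real.enorm_eq_ofReal (by positivity)]
      exact ENNReal.ofReal_le_of_le_toReal (by
        rw [ENNReal.toReal_ofNat]
        exact (div_le_iff₀ ha).2 hba)
    calc eLpNorm (steklovDiff b g) p ν
        ≤ 2 * (eLpNorm (steklovDiff a g) p ν +
            C * ((1 + M : ℝ≥0) * eLpNorm (steklovDiff a g) p ν)) := by
          conv_lhs => rw [h1]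
          rw [eLpNorm_const_smul]
          gcongr
          exact (hν.sub_le hp hDa.locallyIntegrable
            (hDa.locallyIntegrable.sub (hDb.locallyIntegrable.smul _))).trans
              (add_le_add le_rfl hKa)
      _ = _ := by push_cast; ring

theorem exists_eLpNorm_iterate_steklovDiff_le_of_le (p : ℝ≥0∞) (hp : 1 ≤ p) (M : ℝ≥0) (m : ℕ) :
    ∃ C : ℝ≥0, ∀ ν, SteklovBound p ν M → ∀ a b : ℝ, 0 < a → a ≤ b → b ≤ 2 * a →
      ∀ g, IsPeriodicLp p ν g →
        eLpNorm ((steklovDiff a)^[m] g) p ν ≤ C * eLpNorm ((steklovDiff b)^[m] g) p ν ∧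
        eLpNorm ((steklovDiff b)^[m] g) p ν ≤ C * eLpNorm ((steklovDiff a)^[m] g) p ν := by
  obtain ⟨C, hC⟩ := exists_eLpNorm_steklovDiff_le_of_le p hp M
  refine ⟨C ^ m, fun ν hν a b ha hab hba g hg => ?_⟩
  have hb := ha.trans_le hab
  exact ⟨eLpNorm_iterate_steklovDiff_le hν hp ha hb
      (fun g hg => (hC ν hν a b ha hab hba g hg).1) m hg,
    eLpNorm_iterate_steklovDiff_le hν hp hb ha
      (fun g hg => (hC ν hν a b ha hab hba g hg).2) m hg⟩

/-- The case k = 1 is the two-step comparison with b = 2a, where a/b = 1/2. Each further power of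
D_a is traded for one of D_{2a} at the price of another factor 1/2. -/
theorem exists_eLpNorm_iterate_steklovDiff_le_half (p : ℝ≥0∞) (hp : 1 ≤ p) (M : ℝ≥0) (k : ℕ) :
    ∃ C : ℝ≥0, ∀ ν, SteklovBound p ν M → ∀ a : ℝ, 0 < a → ∀ g, IsPeriodicLp p ν g →
      eLpNorm ((steklovDiff a)^[k] g) p ν ≤
        ((1 / 2) ^ k : ℝ≥0) * eLpNorm ((steklovDiff (2 * a))^[k] g) p ν +
          C * eLpNorm ((steklovDiff a)^[k + 1] g) p ν := by
  obtain ⟨K, hK⟩ := exists_eLpNorm_steklovDiff_sub_le p hp M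
  induction k with
  | zero => exact ⟨0, fun ν _ a _ g _ => by simp⟩
  | succ k ih =>
    obtain ⟨C, hC⟩ := ih
    obtain ⟨S, hS⟩ := exists_eLpNorm_iterate_steklovDiff_le_of_le p hp M (k + 1)
    refine ⟨(1 / 2) ^ k * (K * S) + C, fun ν hν a ha g hg => ?_⟩
    have ha2 : 0 < 2 * a := by positivity
    have hDa := hg.steklovDiff hν hp ha
    have hw := hg.iterate_steklovDiff hν hp ha2 k
    have hwa := hw.steklovDiff hν hp ha
    have hwb := hw.steklovDiff hν hp ha2
    set w := (steklovDiff (2 * a))^[k] g with hwdef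
    have h1 := hC ν hν a ha _ hDa
    rw [iterate_steklovDiff_comm ha ha2 hg.locallyIntegrable, ← hwdef,
      ← Function.iterate_succ_apply, ← Function.iterate_succ_apply] at h1
    have h2 : eLpNorm (steklovDiff a w) p ν ≤
        (1 / 2 : ℝ≥0) * eLpNorm (steklovDiff (2 * a) w) p ν +
          K * eLpNorm (steklovDiff a (steklovDiff (2 * a) w)) p ν := by
      have h3 := hK ν hν a (2 * a) ha (by linarith) w hw
      have h4 : a / (2 * a) = ((1 / 2 : ℝ≥0) : ℝ) := by
        push_cast
        field_simp
      rw [h4] at h3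
      have h5 := hν.add_le hp (hwa.locallyIntegrable.sub
        (hwb.locallyIntegrable.smul ((1 / 2 : ℝ≥0) : ℝ)))
        (hwb.locallyIntegrable.smul ((1 / 2 : ℝ≥0) : ℝ))
      rw [sub_add_cancel, eLpNorm_nnreal_smul, add_comm] at h5
      exact h5.trans (add_le_add le_rfl h3)
    -- The error is D_{2a}^{k+1} D_a g; comparability of the steps a and 2a turns it into D_a^{k+2}
    -- g.
    have h6 : eLpNorm (steklovDiff a (steklovDiff (2 * a) w)) p ν ≤
        S * eLpNorm ((steklovDiff a)^[k + 1 + 1] g) p ν := by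
      rw [hwdef, ← Function.iterate_succ_apply' (steklovDiff (2 * a)),
        ← iterate_steklovDiff_comm ha ha2 hg.locallyIntegrable, Function.iterate_succ_apply _ (k + 1)]
      exact (hS ν hν a (2 * a) ha (by linarith) le_rfl _ hDa).2
    rw [Function.iterate_succ_apply' (steklovDiff (2 * a)), ← hwdef]
    calc _ ≤ _ := h1
      _ ≤ ((1 / 2) ^ k : ℝ≥0) * ((1 / 2 : ℝ≥0) * eLpNorm (steklovDiff (2 * a) w) p ν +
          K * (S * eLpNorm ((steklovDiff a)^[k + 1 + 1] g) p ν)) +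
            C * eLpNorm ((steklovDiff a)^[k + 1 + 1] g) p ν := by
          gcongr
          exact h2.trans (by gcongr)
      _ = _ := by
          rw [pow_succ]
          push_cast
          ring

/-- Split g = (g - 2 L_h g) + 2 L_h g. The second term has mean zero, hence is bounded by its
oscillation over a period; the factor 2π / h is at most 8π. -/
theorem exists_eLpNorm_le_steklovDiff_of_mean_zero (p : ℝ≥0∞) (hp : 1 ≤ p) (M : ℝ≥0) :
    ∃ C : ℝ≥0, ∀ ν, SteklovBound p ν M → ∀ h : ℝ, 1 / 4 ≤ h → ∀ g, IsPeriodicLp p ν g →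
      steklov (2 * Real.pi) g = 0 →
      eLpNorm g p ν ≤ C * eLpNorm (steklovDiff h g) p ν := by
  obtain ⟨C, hC⟩ := exists_eLpNorm_sub_two_smul_steklovMoment_le p hp M
  refine ⟨C + 2 * ((8 * Real.pi).toNNReal * M), fun ν hν h hh g hg hg0 => ?_⟩
  have hh0 : 0 < h := by linarith
  have hm := (hg.steklovMoment hν hh0).locallyIntegrable
  have hD := hg.steklovDiff hν hp hh0
  have h1 := hν.add_le hp (hg.locallyIntegrable.sub (hm.smul (2 : ℝ))) (hm.smul (2 : ℝ))
  rw [sub_add_cancel] at h1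
  refine h1.trans ?_
  have h2 := eLpNorm_nnreal_smul (p := p) (ν := ν) 2 (steklovMoment h g)
  rw [NNReal.coe_ofNat] at h2
  rw [h2, ENNReal.coe_add, add_mul, ENNReal.coe_mul, mul_assoc]
  gcongr
  · exact hC ν hν h hh0 g hg
  · rw [ENNReal.coe_mul]
    refine hν.norm_le hD.locallyIntegrable hD.periodic Real.two_pi_pos _ fun x => ?_
    refine (abs_steklovMoment_le_of_mean_zero Real.two_pi_pos hh0 hg.locallyIntegrable hg0 x).trans
      ?_
    rw [Real.coe_toNNReal _ (by positivity)]
    gcongr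
    · exact (abs_nonneg _).trans (abs_steklov_le Real.two_pi_pos _ x)
    · rw [div_le_iff₀ hh0]
      nlinarith [Real.pi_pos]

theorem steklov_period_iterate_steklovDiff (ha : 0 < a) (hg : IsPeriodicLp p ν g)
    (hν : SteklovBound p ν M) (hp : 1 ≤ p) {k : ℕ} (hk : 1 ≤ k) :
    steklov (2 * Real.pi) ((steklovDiff a)^[k] g) = 0 := by
  obtain ⟨k, rfl⟩ := Nat.exists_eq_add_of_le' hk
  have := hg.iterate_steklovDiff hν hp ha k
  rw [Function.iterate_succ_apply']
  exact steklov_period_steklovDiff Real.two_pi_pos ha this.locallyIntegrable this.periodic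

/-- The weights 2^{-k} exactly match t^k at successive dyadic scales, so one constant survives any
number of doublings and the local integrals over (t, 2t] add up. -/
theorem exists_marchaud_of_dyadic_le (k : ℕ) (C₁ C₂ : ℝ≥0) :
    ∃ C : ℝ≥0, 0 < C ∧ ∀ w W : ℝ → ℝ≥0∞,
      (∀ t, 0 < t → w t ≤ ((1 / 2) ^ k : ℝ≥0) * w (2 * t) + C₁ * W t) →
      (∀ t, 1 / 4 ≤ t → w t ≤ C₁ * W t) →
      (∀ t u, 0 < t → t ≤ u → u ≤ 2 * t → W t ≤ C₂ * W u) →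
      ∀ t, 0 < t → t < 1 / 2 →
        w t ≤ C * ENNReal.ofReal (t ^ k) *
          ∫⁻ u in Ioc t 1, W u / ENNReal.ofReal (u ^ k) / ENNReal.ofReal u := by
  -- 2^{k+1} comes from u^{k+1} ≤ (2t)^{k+1} on (t, 2t], an interval of length t; the summand 1 only
  -- makes the constant positive.
  refine ⟨C₁ * C₂ * 2 ^ (k + 1) + 1, by positivity, fun w W hw hbase hW t ht ht2 => ?_⟩
  set C : ℝ≥0 := C₁ * C₂ * 2 ^ (k + 1) + 1 with hCdef
  set I : ℝ → ℝ≥0∞ := fun u => W u / ENNReal.ofReal (u ^ k) / ENNReal.ofReal u with hI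
  have hloc : ∀ t, 0 < t → C₁ * W t ≤
      C * ENNReal.ofReal (t ^ k) * ∫⁻ u in Ioc t (2 * t), I u := by
    intro t ht
    have h1 : ∀ u ∈ Ioc t (2 * t),
        W t / ENNReal.ofReal ((2 * t) ^ k * (2 * t)) ≤ C₂ * I u := by
      intro u hu
      have hu0 : 0 < u := ht.trans hu.1
      have h2 : I u = W u / ENNReal.ofReal (u ^ k * u) := by
        rw [hI, ENNReal.ofReal_mul (by positivity)]
        simp only [div_eq_mul_inv]
        rw [ENNReal.mul_inv, mul_assoc]
        · exact Or.inr ENNReal.ofReal_ne_top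
        · exact Or.inl ENNReal.ofReal_ne_top
      rw [h2, ← mul_div_assoc]
      refine ENNReal.div_le_div (hW t u ht hu.1.le hu.2) (ENNReal.ofReal_le_ofReal ?_)
      have := hu.2
      gcongr
    have h3 : W t / ENNReal.ofReal ((2 * t) ^ k * (2 * t)) * ENNReal.ofReal t ≤
        C₂ * ∫⁻ u in Ioc t (2 * t), I u := by
      rw [← lintegral_const_mul' _ _ ENNReal.coe_ne_top]
      calc _ = ∫⁻ u in Ioc t (2 * t), W t / ENNReal.ofReal ((2 * t) ^ k * (2 * t)) := by
            rw [setLIntegral_const, Real.volume_Ioc]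
            congr 2
            ring
        _ ≤ _ := setLIntegral_mono' measurableSet_Ioc h1
    have h4 : W t = ENNReal.ofReal (2 ^ (k + 1) * t ^ k) *
        (W t / ENNReal.ofReal ((2 * t) ^ k * (2 * t)) * ENNReal.ofReal t) := by
      rw [show (2 * t) ^ k * (2 * t) = 2 ^ (k + 1) * t ^ k * t by ring,
        mul_comm _ (ENNReal.ofReal t), ← mul_assoc, ← ENNReal.ofReal_mul (by positivity),
        ENNReal.mul_div_cancel (by simpa using (by positivity)) ENNReal.ofReal_ne_top]
    calc C₁ * W t ≤ C₁ * (ENNReal.ofReal (2 ^ (k + 1) * t ^ k) *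
          (C₂ * ∫⁻ u in Ioc t (2 * t), I u)) := by
          rw [h4]
          gcongr
      _ = ((C₁ * C₂ * 2 ^ (k + 1) : ℝ≥0) : ℝ≥0∞) * ENNReal.ofReal (t ^ k) *
          ∫⁻ u in Ioc t (2 * t), I u := by
          rw [ENNReal.ofReal_mul (by positivity)]
          push_cast
          rw [ENNReal.ofReal_pow (by norm_num), ENNReal.ofReal_ofNat]
          ring
      _ ≤ _ := by
          gcongr
          rw [hCdef]
          exact le_self_add
  -- Doubling stops once t ≥ 1/4. Below that, 2t < 1/2, so the induction hypothesis applies; t < 1/2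
  -- also keeps (t, 2t] inside (t, 1].
  have key : ∀ n : ℕ, ∀ t, 0 < t → t < 1 / 2 → 1 / 4 ≤ 2 ^ n * t →
      w t ≤ C * ENNReal.ofReal (t ^ k) * ∫⁻ u in Ioc t 1, I u := by
    intro n
    induction n with
    | zero =>
      intro t ht ht2 hn
      refine (hbase t (by simpa using hn)).trans ((hloc t ht).trans ?_)
      gcongr
      linarith
    | succ n ih =>
      intro t ht ht2 hn
      by_cases h4 : 1 / 4 ≤ t
      · refine (hbase t h4).trans ((hloc t ht).trans ?_)
        gcongr
        linarith
      · push Not at h4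
        have h5 := ih (2 * t) (by positivity) (by linarith) (by rw [pow_succ] at hn; linarith)
        have hsplit : ∫⁻ u in Ioc t 1, I u =
            (∫⁻ u in Ioc t (2 * t), I u) + ∫⁻ u in Ioc (2 * t) 1, I u := by
          rw [← Ioc_union_Ioc_eq_Ioc (show t ≤ 2 * t by linarith) (show 2 * t ≤ 1 by linarith),
            lintegral_union measurableSet_Ioc (Ioc_disjoint_Ioc_of_le le_rfl)]
        have h6 : (((1 / 2) ^ k : ℝ≥0) : ℝ≥0∞) * ENNReal.ofReal ((2 * t) ^ k) =
            ENNReal.ofReal (t ^ k) := by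
          rw [← ENNReal.ofReal_coe_nnreal, ← ENNReal.ofReal_mul (by positivity)]
          push_cast
          rw [← mul_pow]
          congr 2
          ring
        calc w t ≤ _ := hw t ht
          _ ≤ ((1 / 2) ^ k : ℝ≥0) * (C * ENNReal.ofReal ((2 * t) ^ k) *
                ∫⁻ u in Ioc (2 * t) 1, I u) +
              C * ENNReal.ofReal (t ^ k) * ∫⁻ u in Ioc t (2 * t), I u := by
              refine add_le_add ?_ (hloc t ht)
              gcongr
          _ = C * ((((1 / 2) ^ k : ℝ≥0) : ℝ≥0∞) * ENNReal.ofReal ((2 * t) ^ k)) *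
                (∫⁻ u in Ioc (2 * t) 1, I u) +
              C * ENNReal.ofReal (t ^ k) * ∫⁻ u in Ioc t (2 * t), I u := by ring
          _ = _ := by rw [h6, hsplit]; ring
  obtain ⟨n, hn⟩ := pow_unbounded_of_one_lt (1 / 4 / t) (one_lt_two (α := ℝ))
  exact key n t ht ht2 ((div_le_iff₀ ht).1 hn.le)

theorem exists_marchaud_of_steklovBound (p : ℝ≥0∞) (hp : 1 ≤ p) (M : ℝ≥0) {k : ℕ} (hk : 1 ≤ k) :
    ∃ C : ℝ≥0, 0 < C ∧ ∀ ν, SteklovBound p ν M → ∀ f, IsPeriodicLp p ν f →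
      ∀ t : ℝ, 0 < t → t < 1 / 2 →
        eLpNorm ((steklovDiff t)^[k] f) p ν ≤ C * ENNReal.ofReal (t ^ k) *
          ∫⁻ u in Ioc t 1, eLpNorm ((steklovDiff u)^[k + 1] f) p ν / ENNReal.ofReal (u ^ k) /
            ENNReal.ofReal u := by
  obtain ⟨A, hA⟩ := exists_eLpNorm_iterate_steklovDiff_le_half p hp M k
  obtain ⟨B, hB⟩ := exists_eLpNorm_le_steklovDiff_of_mean_zero p hp M
  obtain ⟨S, hS⟩ := exists_eLpNorm_iterate_steklovDiff_le_of_le p hp M (k + 1)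
  obtain ⟨C, hC0, hC⟩ := exists_marchaud_of_dyadic_le k (A + B) S
  refine ⟨C, hC0, fun ν hν f hf => ?_⟩
  refine hC (fun t => eLpNorm ((steklovDiff t)^[k] f) p ν)
    (fun t => eLpNorm ((steklovDiff t)^[k + 1] f) p ν) (fun t ht => ?_) (fun t ht => ?_)
    (fun t u ht htu hut => (hS ν hν t u ht htu hut f hf).1)
  · refine (hA ν hν t ht f hf).trans ?_
    gcongr
    exact le_self_add
  · have ht0 : 0 < t := by linarith
    rw [Function.iterate_succ_apply']
    refine (hB ν hν t ht _ (hf.iterate_steklovDiff hν hp ht0 k)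
      (steklov_period_iterate_steklovDiff ht0 hf hν hp hk)).trans ?_
    gcongr
    exact le_add_self

end Powers

/-! ### Integrals of periodic functions over a period. -/

section PeriodicLIntegral

variable {T : ℝ}

theorem Function.Periodic.setLIntegral_Ioc_eq {F : ℝ → ℝ≥0∞} (hF : Function.Periodic F T)
    (hT : 0 < T) (s t : ℝ) : ∫⁻ x in Ioc s (s + T), F x = ∫⁻ x in Ioc t (t + T), F x := by
  have : VAddInvariantMeasure (AddSubgroup.zmultiples T) ℝ volume :=
    ⟨fun c s _ => measure_preimage_add _ _ _⟩
  exact (isAddFundamentalDomain_Ioc hT s).setLIntegral_eq (isAddFundamentalDomain_Ioc hT t) F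
    hF.map_vadd_zmultiples

theorem Function.Periodic.ae_of_ae_restrict_Ioc {α : Type*} {f : ℝ → α} {Q : α → Prop}
    (hf : Function.Periodic f T) (hT : 0 < T) (s : ℝ)
    (h : ∀ᵐ x ∂(volume.restrict (Ioc s (s + T))), Q (f x)) : ∀ᵐ x, Q (f x) := by
  have : VAddInvariantMeasure (AddSubgroup.zmultiples T) ℝ volume :=
    ⟨fun c s _ => measure_preimage_add _ _ _⟩
  refine (isAddFundamentalDomain_Ioc hT s).measure_zero_of_invariant _ (fun g => ?_) ?_
  · ext x
    rw [mem_vadd_set_iff_neg_vadd_mem]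
    simp only [mem_compl_iff, mem_ofPred_eq, hf.map_vadd_zmultiples]
  · rw [← Measure.restrict_apply' measurableSet_Ioc]
    exact h

/-- Fubini after the shift x = a + s: each s in (0, v] contributes one full-period integral. It
turns estimates on single intervals into global ones without a covering argument. -/
theorem lintegral_lintegral_Ioc_add {F : ℝ → ℝ≥0∞} (hF : Function.Periodic F T) (hT : 0 < T)
    (hFm : AEMeasurable F) (t v : ℝ) :
    ∫⁻ a in Ioc t (t + T), ∫⁻ x in Ioc a (a + v), F x =
      ENNReal.ofReal v * ∫⁻ x in Ioc t (t + T), F x := by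
  have h1 : ∀ a u w : ℝ, ∫⁻ x in Ioc (a + u) (a + w), F x = ∫⁻ s in Ioc u w, F (a + s) := by
    intro a u w
    rw [← (measurePreserving_add_left volume a).setLIntegral_comp_preimage_emb
      (measurableEmbedding_addLeft a)]
    simp
  have h2 : ∀ a, ∫⁻ x in Ioc a (a + v), F x = ∫⁻ s in Ioc 0 v, F (a + s) := by
    intro a
    simpa using h1 a 0 v
  have h3 : ∀ s, ∫⁻ a in Ioc t (t + T), F (a + s) = ∫⁻ x in Ioc t (t + T), F x := by
    intro s
    simp only [add_comm _ s]
    rw [← h1, ← add_assoc]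
    exact hF.setLIntegral_Ioc_eq hT _ _
  simp only [h2]
  rw [lintegral_lintegral_swap]
  · simp only [h3, setLIntegral_const, Real.volume_Ioc, sub_zero]
    rw [mul_comm]
  · rw [Measure.prod_restrict]
    exact (hFm.comp_quasiMeasurePreserving
      (quasiMeasurePreserving_add (volume : Measure ℝ) (volume : Measure ℝ))).restrict

theorem locallyIntegrable_of_periodic {f : ℝ → ℝ} (hf : Function.Periodic f T) (hT : 0 < T) (t : ℝ)
    (hi : IntegrableOn f (Ioc t (t + T))) : LocallyIntegrable f := by
  have h1 := hf.intervalIntegrable hT.ne'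
    ((intervalIntegrable_iff_integrableOn_Ioc_of_le (by linarith)).2 hi)
  rw [locallyIntegrable_iff]
  intro K hK
  obtain ⟨a, ha⟩ := hK.bddBelow
  obtain ⟨b, hb⟩ := hK.bddAbove
  have h2 : IntegrableOn f (Ioc (a - 1) b) := (h1 (a - 1) b).1
  exact h2.mono_set fun x hx => ⟨by linarith [ha hx], hb hx⟩

end PeriodicLIntegral

/-! ### Uniform boundedness of Steklov means in the weighted spaces. -/

section Weights

variable {p : ℝ≥0∞} {γ : ℝ → ℝ≥0∞} {f : ℝ → ℝ}

/-- The estimate `γ(I) (∫_I |f|)^P ≤ K |I|^P ∫_I |f|^P γ` on the intervals `I` of the circle. -/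
def IntervalBound (P : ℝ) (γ : ℝ → ℝ≥0∞) (K : ℝ≥0) : Prop :=
  ∀ (f : ℝ → ℝ) (a b : ℝ), a < b → b ≤ a + 2 * Real.pi →
    AEMeasurable f (volume.restrict (Icc a b)) →
    (∫⁻ x in Icc a b, γ x) * (∫⁻ x in Icc a b, ‖f x‖ₑ) ^ P ≤
      K * ENNReal.ofReal (b - a) ^ P * ∫⁻ x in Icc a b, ‖f x‖ₑ ^ P * γ x

theorem neg_pi_add_two_pi : -Real.pi + 2 * Real.pi = Real.pi := by ring

theorem weightedMeasure_absolutelyContinuous (γ : ℝ → ℝ≥0∞) : weightedMeasure γ ≪ volume :=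
  (withDensity_absolutelyContinuous _ _).trans Measure.restrict_le_self.absolutelyContinuous

theorem IsWeight.restrict_absolutelyContinuous (hγ : IsWeight γ) :
    volume.restrict (Ioc (-Real.pi) Real.pi) ≪ weightedMeasure γ :=
  withDensity_absolutelyContinuous' hγ.measurable.aemeasurable
    (ae_restrict_of_ae (hγ.pos.mono fun _ h => h.ne'))

theorem eLpNorm_weightedMeasure (hp : 1 ≤ p) (hp' : p ≠ ∞) (hγ : Measurable γ)
    (hf : AEMeasurable f (volume.restrict (Ioc (-Real.pi) Real.pi))) :
    eLpNorm f p (weightedMeasure γ) =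
      (∫⁻ x in Ioc (-Real.pi) Real.pi, ‖f x‖ₑ ^ p.toReal * γ x) ^ (1 / p.toReal) := by
  rw [eLpNorm_eq_lintegral_rpow_enorm_toReal (zero_lt_one.trans_le hp).ne' hp', weightedMeasure,
    lintegral_withDensity_eq_lintegral_mul₀ hγ.aemeasurable (hf.enorm.pow_const _)]
  simp only [Pi.mul_apply, mul_comm]

theorem enorm_steklov_abs {h : ℝ} (hh : 0 < h) (hf : LocallyIntegrable f) (x : ℝ) :
    ‖steklov h (fun s => |f s|) x‖ₑ =
      ENNReal.ofReal (1 / h) * ∫⁻ s in Ioc x (x + h), ‖f s‖ₑ := by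
  rw [steklov_apply hh, enorm_mul, Real.enorm_eq_ofReal (by positivity),
    intervalIntegral.integral_of_le (by linarith)]
  congr 1
  rw [Real.enorm_eq_ofReal (integral_nonneg fun _ => abs_nonneg _)]
  exact ofReal_integral_norm_eq_lintegral_enorm (hf.intervalIntegrable_real x (x + h)).1

theorem lintegral_steklov_le_of_le_pi {P : ℝ} (hP : 1 ≤ P) (hγ : IsWeight γ) {K : ℝ≥0}
    (hK : IntervalBound P γ K) (hf : LocallyIntegrable f)
    (hfp : Function.Periodic f (2 * Real.pi)) {v : ℝ} (hv : 0 < v) (hvpi : v ≤ Real.pi) :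
    ∫⁻ x in Ioc (-Real.pi) Real.pi, ‖steklov v (fun s => |f s|) x‖ₑ ^ P * γ x ≤
      2 * 2 ^ P * K * ∫⁻ x in Ioc (-Real.pi) Real.pi, ‖f x‖ₑ ^ P * γ x := by
  have hP0 : 0 < P := by linarith
  set F : ℝ → ℝ≥0∞ := fun x => ‖steklov v (fun s => |f s|) x‖ₑ ^ P * γ x with hF
  set G : ℝ → ℝ≥0∞ := fun x => ‖f x‖ₑ ^ P * γ x with hG
  have hFp : Function.Periodic F (2 * Real.pi) := fun x => by
    have := periodic_steklov hv (f := fun s => |f s|) (T := 2 * Real.pi) fun x => by simp [hfp x]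
    simp only [hF, this x, hγ.periodic x]
  have hGp : Function.Periodic G (2 * Real.pi) := fun x => by
    simp only [hG, hfp x, hγ.periodic x]
  have hFm : AEMeasurable F :=
    ((continuous_steklov hv (locallyIntegrable_abs hf)).measurable.enorm.pow_const P).mul
      hγ.measurable |>.aemeasurable
  have hGm : AEMeasurable G :=
    (hf.aestronglyMeasurable.aemeasurable.enorm.pow_const P).mul hγ.measurable.aemeasurable
  have h1 := lintegral_lintegral_Ioc_add hFp Real.two_pi_pos hFm (-Real.pi) v
  have h2 := lintegral_lintegral_Ioc_add hGp Real.two_pi_pos hGm (-Real.pi) (2 * v)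
  rw [neg_pi_add_two_pi] at h1 h2
  -- For x in (a, a + v] the averaging window lies in (a, a + 2v], which is an interval of the
  -- circle because v ≤ π.
  have h3 : ∀ a, ∫⁻ x in Ioc a (a + v), F x ≤ 2 ^ P * K * ∫⁻ x in Ioc a (a + 2 * v), G x := by
    intro a
    have hQ := hK f a (a + 2 * v) (by linarith) (by linarith)
      hf.aestronglyMeasurable.aemeasurable.restrict
    have hIcc : ∀ H : ℝ → ℝ≥0∞, ∫⁻ x in Icc a (a + 2 * v), H x = ∫⁻ x in Ioc a (a + 2 * v), H x :=
      fun H => setLIntegral_congr Ioc_ae_eq_Icc.symm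
    rw [hIcc, hIcc, hIcc, add_sub_cancel_left] at hQ
    calc ∫⁻ x in Ioc a (a + v), F x
        ≤ ∫⁻ x in Ioc a (a + v),
            (ENNReal.ofReal (1 / v) * ∫⁻ s in Ioc a (a + 2 * v), ‖f s‖ₑ) ^ P * γ x := by
          refine setLIntegral_mono' measurableSet_Ioc fun x hx => ?_
          simp only [hF, enorm_steklov_abs hv hf]
          exact mul_le_mul' (ENNReal.rpow_le_rpow (mul_le_mul' le_rfl (lintegral_mono_set
            (Ioc_subset_Ioc hx.1.le (by linarith [hx.2])))) hP0.le) le_rfl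
      _ = (ENNReal.ofReal (1 / v) * ∫⁻ s in Ioc a (a + 2 * v), ‖f s‖ₑ) ^ P *
            ∫⁻ x in Ioc a (a + v), γ x := lintegral_const_mul _ hγ.measurable
      _ ≤ (ENNReal.ofReal (1 / v) * ∫⁻ s in Ioc a (a + 2 * v), ‖f s‖ₑ) ^ P *
            ∫⁻ x in Ioc a (a + 2 * v), γ x := by
          exact mul_le_mul' le_rfl (lintegral_mono_set
            (Ioc_subset_Ioc le_rfl (by linarith)))
      _ = ENNReal.ofReal (1 / v) ^ P * ((∫⁻ x in Ioc a (a + 2 * v), γ x) *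
            (∫⁻ s in Ioc a (a + 2 * v), ‖f s‖ₑ) ^ P) := by
          rw [ENNReal.mul_rpow_of_nonneg _ _ hP0.le]
          ring
      _ ≤ ENNReal.ofReal (1 / v) ^ P * (K * ENNReal.ofReal (2 * v) ^ P *
            ∫⁻ x in Ioc a (a + 2 * v), G x) := by gcongr
      _ = (ENNReal.ofReal (1 / v) * ENNReal.ofReal (2 * v)) ^ P * K *
            ∫⁻ x in Ioc a (a + 2 * v), G x := by
          rw [ENNReal.mul_rpow_of_nonneg _ _ hP0.le]
          ring
      _ = _ := by
          rw [← ENNReal.ofReal_mul (by positivity), show 1 / v * (2 * v) = 2 by field_simp,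
            ENNReal.ofReal_ofNat]
  have h4 : ENNReal.ofReal v * ∫⁻ x in Ioc (-Real.pi) Real.pi, F x ≤
      ENNReal.ofReal v * (2 * 2 ^ P * K * ∫⁻ x in Ioc (-Real.pi) Real.pi, G x) := by
    rw [← h1]
    refine (lintegral_mono h3).trans ?_
    rw [lintegral_const_mul' _ _ (ENNReal.mul_ne_top
      (ENNReal.rpow_ne_top_of_nonneg hP0.le ENNReal.ofNat_ne_top) ENNReal.coe_ne_top), h2,
      ENNReal.ofReal_mul zero_le_two, ENNReal.ofReal_ofNat]
    exact le_of_eq (by ring)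
  exact (ENNReal.mul_le_mul_iff_right (by simpa using hv) ENNReal.ofReal_ne_top).1 h4

theorem steklov_abs_le_of_pi_lt (hf : LocallyIntegrable f)
    (hfp : Function.Periodic f (2 * Real.pi)) {v : ℝ} (hv : Real.pi < v) (x : ℝ) :
    ‖steklov v (fun s => |f s|) x‖ₑ ≤
      ENNReal.ofReal (3 / (2 * Real.pi)) * ∫⁻ s in Icc (-Real.pi) Real.pi, ‖f s‖ₑ := by
  have hpi := Real.pi_pos
  have hv0 : 0 < v := hpi.trans hv
  -- The window fits in n full periods, and n / v ≤ 1/(2π) + 1/v ≤ 3/(2π) since v > π.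
  set n := ⌈v / (2 * Real.pi)⌉₊ with hn
  have hn1 : v ≤ n * (2 * Real.pi) := (div_le_iff₀ Real.two_pi_pos).1 (Nat.le_ceil _)
  have hn2 : (n : ℝ) ≤ v / (2 * Real.pi) + 1 := (Nat.ceil_lt_add_one (by positivity)).le
  have hap : Function.Periodic (fun s => |f s|) (2 * Real.pi) := fun s => by simp [hfp s]
  have h1 := integral_abs_mono hf (le_refl x) (by linarith) (add_le_add (le_refl x) hn1)
  have h2 := hap.intervalIntegral_add_zsmul_eq n x
    ((locallyIntegrable_abs hf).intervalIntegrable_real)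
  simp only [zsmul_eq_mul, Int.cast_natCast] at h2
  rw [hap.intervalIntegral_add_eq x (-Real.pi), neg_pi_add_two_pi] at h2
  rw [h2] at h1
  have h0 : 0 ≤ ∫ s in (-Real.pi)..Real.pi, |f s| :=
    intervalIntegral.integral_nonneg (by linarith) fun _ _ => abs_nonneg _
  have h3 : ∫⁻ s in Icc (-Real.pi) Real.pi, ‖f s‖ₑ =
      ENNReal.ofReal (∫ s in (-Real.pi)..Real.pi, |f s|) := by
    rw [setLIntegral_congr Ioc_ae_eq_Icc.symm, intervalIntegral.integral_of_le (by linarith)]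
    exact (ofReal_integral_norm_eq_lintegral_enorm
      (hf.intervalIntegrable_real (-Real.pi) Real.pi).1).symm
  have h4 : 0 ≤ steklov v (fun s => |f s|) x := (abs_nonneg _).trans (abs_steklov_le hv0 f x)
  rw [h3, ← ENNReal.ofReal_mul (by positivity), Real.enorm_eq_ofReal h4]
  refine ENNReal.ofReal_le_ofReal ?_
  rw [steklov_apply hv0]
  calc (1 / v) * ∫ s in x..(x + v), |f s|
      ≤ (1 / v) * ((v / (2 * Real.pi) + 1) * ∫ s in (-Real.pi)..Real.pi, |f s|) := by
        gcongr
        exact h1.trans (by gcongr)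
    _ = (1 / (2 * Real.pi) + 1 / v) * ∫ s in (-Real.pi)..Real.pi, |f s| := by
        field_simp
    _ ≤ (1 / (2 * Real.pi) + 1 / Real.pi) * ∫ s in (-Real.pi)..Real.pi, |f s| := by gcongr
    _ = _ := by field_simp; ring

theorem lintegral_steklov_le_of_pi_lt {P : ℝ} (hP : 1 ≤ P) (hγ : IsWeight γ) {K : ℝ≥0}
    (hK : IntervalBound P γ K) (hf : LocallyIntegrable f)
    (hfp : Function.Periodic f (2 * Real.pi)) {v : ℝ} (hv : Real.pi < v) :
    ∫⁻ x in Ioc (-Real.pi) Real.pi, ‖steklov v (fun s => |f s|) x‖ₑ ^ P * γ x ≤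
      3 ^ P * K * ∫⁻ x in Ioc (-Real.pi) Real.pi, ‖f x‖ₑ ^ P * γ x := by
  have hP0 : 0 < P := by linarith
  have hpi := Real.pi_pos
  have hIcc : ∀ H : ℝ → ℝ≥0∞, ∫⁻ x in Ioc (-Real.pi) Real.pi, H x =
      ∫⁻ x in Icc (-Real.pi) Real.pi, H x := fun H => setLIntegral_congr Ioc_ae_eq_Icc
  rw [hIcc, hIcc]
  have hQ := hK f (-Real.pi) Real.pi (by linarith) (by linarith)
    hf.aestronglyMeasurable.aemeasurable.restrict
  set N := ∫⁻ s in Icc (-Real.pi) Real.pi, ‖f s‖ₑ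
  calc _ ≤ ∫⁻ x in Icc (-Real.pi) Real.pi,
        (ENNReal.ofReal (3 / (2 * Real.pi)) * N) ^ P * γ x := by
        refine lintegral_mono fun x => ?_
        gcongr
        exact steklov_abs_le_of_pi_lt hf hfp hv x
    _ = (ENNReal.ofReal (3 / (2 * Real.pi)) * N) ^ P * ∫⁻ x in Icc (-Real.pi) Real.pi, γ x :=
        lintegral_const_mul _ hγ.measurable
    _ = ENNReal.ofReal (3 / (2 * Real.pi)) ^ P *
        ((∫⁻ x in Icc (-Real.pi) Real.pi, γ x) * N ^ P) := by
        rw [ENNReal.mul_rpow_of_nonneg _ _ hP0.le]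
        ring
    _ ≤ ENNReal.ofReal (3 / (2 * Real.pi)) ^ P * (K * ENNReal.ofReal (Real.pi - -Real.pi) ^ P *
          ∫⁻ x in Icc (-Real.pi) Real.pi, ‖f x‖ₑ ^ P * γ x) := by gcongr
    _ = (ENNReal.ofReal (3 / (2 * Real.pi)) * ENNReal.ofReal (Real.pi - -Real.pi)) ^ P * K *
          ∫⁻ x in Icc (-Real.pi) Real.pi, ‖f x‖ₑ ^ P * γ x := by
        rw [ENNReal.mul_rpow_of_nonneg _ _ hP0.le]
        ring
    _ = _ := by
        rw [← ENNReal.ofReal_mul (by positivity),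
          show 3 / (2 * Real.pi) * (Real.pi - -Real.pi) = 3 by field_simp; ring,
          ENNReal.ofReal_ofNat]

theorem exists_steklovBound_of_intervalBound (p : ℝ≥0∞) (hp : 1 ≤ p) (hp' : p ≠ ∞) (K : ℝ≥0) :
    ∃ M : ℝ≥0, ∀ γ, IsWeight γ → IntervalBound p.toReal γ K →
      SteklovBound p (weightedMeasure γ) M := by
  have hP : 1 ≤ p.toReal := by
    simpa using ENNReal.toReal_mono hp' hp
  have hP0 : 0 < p.toReal := by linarith
  set L : ℝ≥0 := (2 * 2 ^ p.toReal + 3 ^ p.toReal) * K with hL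
  refine ⟨L ^ (1 / p.toReal), fun γ hγ hK => ⟨weightedMeasure_absolutelyContinuous γ,
    fun f hf hfp v hv => ?_⟩⟩
  have hm := (locallyIntegrable_steklov hv
    (locallyIntegrable_abs hf)).aestronglyMeasurable.aemeasurable
  rw [eLpNorm_weightedMeasure hp hp' hγ.measurable hm.restrict,
    eLpNorm_weightedMeasure hp hp' hγ.measurable hf.aestronglyMeasurable.aemeasurable.restrict,
    ENNReal.coe_rpow_of_nonneg _ (by positivity), ← ENNReal.mul_rpow_of_nonneg _ _ (by positivity)]
  gcongr
  rcases le_or_gt v Real.pi with h | h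
  · refine (lintegral_steklov_le_of_le_pi hP hγ hK hf hfp hv h).trans ?_
    gcongr
    rw [hL]
    push_cast
    rw [ENNReal.coe_rpow_of_nonneg _ hP0.le, ENNReal.coe_rpow_of_nonneg _ hP0.le]
    push_cast
    gcongr
    exact le_self_add
  · refine (lintegral_steklov_le_of_pi_lt hP hγ hK hf hfp h).trans ?_
    gcongr
    rw [hL]
    push_cast
    rw [ENNReal.coe_rpow_of_nonneg _ hP0.le, ENNReal.coe_rpow_of_nonneg _ hP0.le]
    push_cast
    gcongr
    exact le_add_self

theorem isPeriodicLp_of_memWeightedLp (hγ : IsWeight γ) (hf : MemWeightedLp p γ f)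
    (hi : ∫⁻ x in Ioc (-Real.pi) Real.pi, ‖f x‖ₑ ≠ ∞) :
    IsPeriodicLp p (weightedMeasure γ) f := by
  refine ⟨hf.1, locallyIntegrable_of_periodic hf.1 Real.two_pi_pos (-Real.pi) ?_, hf.2.2.ne⟩
  rw [neg_pi_add_two_pi]
  exact ⟨hf.2.1.mono_ac hγ.restrict_absolutelyContinuous, lt_top_iff_ne_top.2 hi⟩

/-- If |f| had infinite integral over the period, the left side of the interval bound would be
infinite, as γ has positive total mass, while the right side is finite. -/
theorem isPeriodicLp_of_intervalBound (hp : 1 ≤ p) (hp' : p ≠ ∞) (hγ : IsWeight γ) {K : ℝ≥0}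
    (hK : IntervalBound p.toReal γ K) (hf : MemWeightedLp p γ f) :
    IsPeriodicLp p (weightedMeasure γ) f := by
  have hP : 1 ≤ p.toReal := by
    simpa using ENNReal.toReal_mono hp' hp
  have hP0 : 0 < p.toReal := by linarith
  have hpi := Real.pi_pos
  have hm := (hf.2.1.mono_ac hγ.restrict_absolutelyContinuous).aemeasurable
  refine isPeriodicLp_of_memWeightedLp hγ hf fun htop => ?_
  have hIcc : ∀ H : ℝ → ℝ≥0∞, ∫⁻ x in Icc (-Real.pi) Real.pi, H x =
      ∫⁻ x in Ioc (-Real.pi) Real.pi, H x := fun H => setLIntegral_congr Ioc_ae_eq_Icc.symm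
  have hQ := hK f (-Real.pi) Real.pi (by linarith) (by linarith)
    (by rwa [← restrict_Ioc_eq_restrict_Icc])
  have hfin := hf.2.2
  rw [eLpNorm_weightedMeasure hp hp' hγ.measurable hm] at hfin
  have hJ : ∫⁻ x in Ioc (-Real.pi) Real.pi, ‖f x‖ₑ ^ p.toReal * γ x ≠ ∞ := fun h => by
    rw [h, ENNReal.top_rpow_of_pos (by positivity)] at hfin
    exact lt_irrefl _ hfin
  have hγ0 : ∫⁻ x in Ioc (-Real.pi) Real.pi, γ x ≠ 0 := fun h => by
    rw [lintegral_eq_zero_iff hγ.measurable] at h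
    have h2 : ∀ᵐ x ∂(volume.restrict (Ioc (-Real.pi) Real.pi)), False := by
      filter_upwards [h, ae_restrict_of_ae hγ.pos] with x h3 h4
      exact h4.ne' h3
    have : (ae (volume.restrict (Ioc (-Real.pi) Real.pi))).NeBot := by
      rw [ae_restrict_neBot, Real.volume_Ioc]
      exact (ENNReal.ofReal_pos.2 (by linarith)).ne'
    exact h2.exists.choose_spec
  rw [hIcc, hIcc, hIcc, htop, ENNReal.top_rpow_of_pos hP0, ENNReal.mul_top hγ0, top_le_iff] at hQ
  exact ENNReal.mul_ne_top (ENNReal.mul_ne_top ENNReal.coe_ne_top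
    (ENNReal.rpow_ne_top_of_nonneg hP0.le ENNReal.ofReal_ne_top)) hJ hQ

/-- The average of γ is at most A, and |f| ≤ |f| γ / c almost everywhere. -/
theorem intervalBound_one {A c : ℝ≥0} (hc : 0 < c) (hA : averageConst γ ≤ A)
    (hcγ : ∀ᵐ x, (c : ℝ≥0∞) ≤ γ x) : IntervalBound 1 γ (A / c) := by
  intro f a b hab hb _
  have h1 : (∫⁻ x in Icc a b, γ x) ≤ A * ENNReal.ofReal (b - a) := by
    rw [← ENNReal.div_le_iff (by simpa using hab) ENNReal.ofReal_ne_top]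
    refine le_trans ?_ hA
    exact le_iSup₂_of_le a b (le_iSup₂_of_le hab hb le_rfl)
  have h2 : ∫⁻ x in Icc a b, ‖f x‖ₑ ≤ (c : ℝ≥0∞)⁻¹ * ∫⁻ x in Icc a b, ‖f x‖ₑ * γ x := by
    rw [← lintegral_const_mul' _ _ (by simpa using hc.ne')]
    refine lintegral_mono_ae ((ae_restrict_of_ae hcγ).mono fun x hx => ?_)
    calc ‖f x‖ₑ = (c : ℝ≥0∞)⁻¹ * (‖f x‖ₑ * c) := by
          rw [mul_comm ‖f x‖ₑ, ← mul_assoc, ENNReal.inv_mul_cancel (by simpa using hc.ne')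
            ENNReal.coe_ne_top, one_mul]
      _ ≤ _ := by gcongr
  simp only [ENNReal.rpow_one]
  refine (mul_le_mul' h1 h2).trans_eq ?_
  rw [ENNReal.coe_div hc.ne', div_eq_mul_inv]
  ring

/-- Hölder applied to |f| = (|f| γ^{1/P}) γ^{-1/P}, followed by the Muckenhoupt condition on the
same interval. The factorisation needs 0 < γ < ∞ almost everywhere; finiteness comes from
integrability over a period. -/
theorem intervalBound_muckenhoupt {P : ℝ} (hP : 1 < P) {A : ℝ≥0} (hγ : IsDoublingWeight γ)
    (hA : muckenhouptConst P γ ≤ A) : IntervalBound P γ A := by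
  intro f a b hab hb hf
  have hP0 : 0 < P := by linarith
  have hP1 : 0 < P - 1 := by linarith
  have hfin : ∀ᵐ x, γ x < ∞ := by
    refine hγ.periodic.ae_of_ae_restrict_Ioc (Q := fun y => y < ∞) Real.two_pi_pos (-Real.pi) ?_
    rw [neg_pi_add_two_pi]
    exact ae_lt_top hγ.measurable hγ.integrable.ne
  set ℓ := ENNReal.ofReal (b - a) with hℓ
  have hℓ0 : ℓ ≠ 0 := by simpa [hℓ] using hab
  have hℓt : ℓ ≠ ∞ := ENNReal.ofReal_ne_top
  set S := ∫⁻ x in Icc a b, γ x ^ (-1 / (P - 1)) with hS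
  have hpq : P.HolderConjugate (P / (P - 1)) := Real.HolderConjugate.conjExponent hP
  have h1 : (∫⁻ x in Icc a b, ‖f x‖ₑ) ^ P ≤
      (∫⁻ x in Icc a b, ‖f x‖ₑ ^ P * γ x) * S ^ (P - 1) := by
    have h2 := ENNReal.lintegral_mul_le_Lp_mul_Lq (volume.restrict (Icc a b)) hpq
      (f := fun x => ‖f x‖ₑ * γ x ^ (1 / P)) (g := fun x => γ x ^ (-(1 / P)))
      (hf.enorm.mul (hγ.measurable.pow_const _).aemeasurable)
      (hγ.measurable.pow_const _).aemeasurable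
    have h3 : ∫⁻ x in Icc a b, ((fun x => ‖f x‖ₑ * γ x ^ (1 / P)) * fun x => γ x ^ (-(1 / P))) x =
        ∫⁻ x in Icc a b, ‖f x‖ₑ := by
      refine lintegral_congr_ae ?_
      filter_upwards [ae_restrict_of_ae hfin, ae_restrict_of_ae hγ.pos] with x hx1 hx2
      rw [Pi.mul_apply, mul_assoc, ← ENNReal.rpow_add _ _ hx2.ne' hx1.ne, add_neg_cancel,
        ENNReal.rpow_zero, mul_one]
    have h4 : ∀ x, (‖f x‖ₑ * γ x ^ (1 / P)) ^ P = ‖f x‖ₑ ^ P * γ x := fun x => by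
      rw [ENNReal.mul_rpow_of_nonneg _ _ hP0.le, ← ENNReal.rpow_mul, one_div_mul_cancel hP0.ne',
        ENNReal.rpow_one]
    have h5 : ∀ x, (γ x ^ (-(1 / P))) ^ (P / (P - 1)) = γ x ^ (-1 / (P - 1)) := fun x => by
      rw [← ENNReal.rpow_mul]
      congr 1
      field_simp
    rw [h3] at h2
    simp only [h4, h5] at h2
    refine (ENNReal.rpow_le_rpow h2 hP0.le).trans_eq ?_
    rw [ENNReal.mul_rpow_of_nonneg _ _ hP0.le, ← ENNReal.rpow_mul, ← ENNReal.rpow_mul,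
      one_div_mul_cancel hP0.ne', ENNReal.rpow_one]
    congr 2
    field_simp
  have h6 : (∫⁻ x in Icc a b, γ x) / ℓ * (S / ℓ) ^ (P - 1) ≤ A := by
    refine le_trans ?_ hA
    exact le_iSup₂_of_le a b (le_iSup₂_of_le hab hb le_rfl)
  have h7 : (∫⁻ x in Icc a b, γ x) * S ^ (P - 1) ≤ A * ℓ ^ P := by
    have h8 : ℓ ^ P = ℓ * ℓ ^ (P - 1) := by
      conv_lhs => rw [show P = 1 + (P - 1) by ring]
      rw [ENNReal.rpow_add _ _ hℓ0 hℓt, ENNReal.rpow_one]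
    calc _ = ((∫⁻ x in Icc a b, γ x) / ℓ * ℓ) * (S / ℓ * ℓ) ^ (P - 1) := by
          rw [ENNReal.div_mul_cancel hℓ0 hℓt, ENNReal.div_mul_cancel hℓ0 hℓt]
      _ = ((∫⁻ x in Icc a b, γ x) / ℓ * (S / ℓ) ^ (P - 1)) * (ℓ * ℓ ^ (P - 1)) := by
          rw [ENNReal.mul_rpow_of_nonneg _ _ hP1.le]
          ring
      _ ≤ _ := by
          rw [← h8]
          gcongr
  calc _ ≤ (∫⁻ x in Icc a b, γ x) *
        ((∫⁻ x in Icc a b, ‖f x‖ₑ ^ P * γ x) * S ^ (P - 1)) := by gcongr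
    _ = ((∫⁻ x in Icc a b, γ x) * S ^ (P - 1)) * ∫⁻ x in Icc a b, ‖f x‖ₑ ^ P * γ x := by ring
    _ ≤ _ := by gcongr

theorem weightedMeasure_of_ae_eq_one (hγ : ∀ᵐ x, γ x = 1) :
    weightedMeasure γ = volume.restrict (Ioc (-Real.pi) Real.pi) := by
  rw [weightedMeasure, withDensity_congr_ae (ae_restrict_of_ae hγ)]
  exact withDensity_one

/-- Periodicity spreads the essential bound from one period to the line, and averages respect it. -/
theorem steklovBound_top (hγ : ∀ᵐ x, γ x = 1) : SteklovBound ∞ (weightedMeasure γ) 1 := by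
  refine ⟨weightedMeasure_absolutelyContinuous γ, fun f hf hfp v hv => ?_⟩
  rw [ENNReal.coe_one, one_mul, weightedMeasure_of_ae_eq_one hγ, eLpNorm_exponent_top,
    eLpNorm_exponent_top]
  set B := eLpNormEssSup f (volume.restrict (Ioc (-Real.pi) Real.pi)) with hB
  have hae : ∀ᵐ x, ‖f x‖ₑ ≤ B := by
    refine hfp.ae_of_ae_restrict_Ioc (Q := fun y => ‖y‖ₑ ≤ B) Real.two_pi_pos (-Real.pi) ?_
    rw [neg_pi_add_two_pi]
    exact enorm_ae_le_eLpNormEssSup f _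
  refine eLpNormEssSup_le_of_ae_enorm_bound (Filter.Eventually.of_forall fun x => ?_)
  rw [enorm_steklov_abs hv hf]
  calc _ ≤ ENNReal.ofReal (1 / v) * ∫⁻ s in Ioc x (x + v), B := by
        exact mul_le_mul' le_rfl (lintegral_mono_ae (ae_restrict_of_ae hae))
    _ = B := by
        rw [setLIntegral_const, Real.volume_Ioc, add_sub_cancel_left, mul_comm B, ← mul_assoc,
          ← ENNReal.ofReal_mul (by positivity), one_div_mul_cancel hv.ne', ENNReal.ofReal_one,
          one_mul]

theorem isPeriodicLp_top (hγ : IsWeight γ) (hγ1 : ∀ᵐ x, γ x = 1) (hf : MemWeightedLp ∞ γ f) :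
    IsPeriodicLp ∞ (weightedMeasure γ) f := by
  refine isPeriodicLp_of_memWeightedLp hγ hf ?_
  have h := hf.2
  rw [weightedMeasure_of_ae_eq_one hγ1] at h
  exact (h.integrable le_top).2.ne

end Weights

theorem mainTheorem8 (p : ℝ≥0∞) (hp : 1 ≤ p) (k : ℕ) (hk : 1 ≤ k) :
    (p ≠ 1 → ∀ A : ℝ≥0, ∃ C : ℝ≥0, 0 < C ∧
      ∀ γ : ℝ → ℝ≥0∞, IsClassAS p γ → weightConst p γ ≤ A →
      ∀ f : ℝ → ℝ, MemWeightedLp p γ f → ∀ t : ℝ, 0 < t → t < 1 / 2 →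
        modulus p γ k f t ≤
          C * ENNReal.ofReal (t ^ k) *
            ∫⁻ u in Set.Ioc t 1,
              modulus p γ (k + 1) f u / ENNReal.ofReal (u ^ k) / ENNReal.ofReal u) ∧
    (p = 1 → ∀ A c : ℝ≥0, 0 < c → ∃ C : ℝ≥0, 0 < C ∧
      ∀ γ : ℝ → ℝ≥0∞, IsClassAS p γ → weightConst p γ ≤ A → (∀ᵐ x, (c : ℝ≥0∞) ≤ γ x) →
      ∀ f : ℝ → ℝ, MemWeightedLp p γ f → ∀ t : ℝ, 0 < t → t < 1 / 2 →
        modulus p γ k f t ≤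
          C * ENNReal.ofReal (t ^ k) *
            ∫⁻ u in Set.Ioc t 1,
              modulus p γ (k + 1) f u / ENNReal.ofReal (u ^ k) / ENNReal.ofReal u) := by
  refine ⟨fun hp1 A => ?_, ?_⟩
  · by_cases htop : p = ∞
    · subst htop
      obtain ⟨C, hC0, hC⟩ := exists_marchaud_of_steklovBound ∞ hp 1 hk
      refine ⟨C, hC0, fun γ hγ _ f hf => ?_⟩
      simp only [IsClassAS, if_neg hp1, if_true] at hγ
      -- `modulus` unfolds definitionally to the `eLpNorm` of iterates of `steklovDiff`, so the
      -- abstract inequality is the goal itself.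
      exact hC _ (steklovBound_top hγ.2) f (isPeriodicLp_top hγ.1 hγ.2 hf)
    · have hP : 1 < p.toReal := by
        simpa using (ENNReal.toReal_lt_toReal ENNReal.one_ne_top htop).2 (lt_of_le_of_ne' hp hp1)
      obtain ⟨M, hM⟩ := exists_steklovBound_of_intervalBound p hp htop A
      obtain ⟨C, hC0, hC⟩ := exists_marchaud_of_steklovBound p hp M hk
      refine ⟨C, hC0, fun γ hγ hA f hf => ?_⟩
      simp only [IsClassAS, weightConst, if_neg hp1, if_neg htop] at hγ hA
      have hK := intervalBound_muckenhoupt hP hγ.1 hA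
      exact hC _ (hM γ hγ.1.toIsWeight hK) f
        (isPeriodicLp_of_intervalBound hp htop hγ.1.toIsWeight hK hf)
  · rintro rfl A c hc
    obtain ⟨M, hM⟩ := exists_steklovBound_of_intervalBound 1 hp ENNReal.one_ne_top (A / c)
    obtain ⟨C, hC0, hC⟩ := exists_marchaud_of_steklovBound 1 hp M hk
    refine ⟨C, hC0, fun γ hγ hA hcγ f hf => ?_⟩
    simp only [IsClassAS, weightConst, if_true] at hγ hA
    have hK : IntervalBound (1 : ℝ≥0∞).toReal γ (A / c) := by
      rw [ENNReal.toReal_one]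
      exact intervalBound_one hc hA hcγ
    exact hC _ (hM γ hγ.1 hK) f
      (isPeriodicLp_of_intervalBound hp ENNReal.one_ne_top hγ.1 hK hf)
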